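/- Let $\mathcal X$ be a measurable space (e.g. a Borel subset of $\mathbb R^d$), $\mathcal Y$ a finite set of labels, and $\mathrm p^*$ a probability measure on $\mathcal X\times\mathcal Y$. Let $(x_1,y_1),\dots,(x_n,y_n)$, $n\ge 1$, be independent samples from $\mathrm p^*$. Let $\mathcal F$ be a family of measurable functions $\psi:\mathcal X\to\mathbb R$ (scalar features) with $|\psi(x)|\le C$ for all $\psi\in\mathcal F$, $x\in\mathcal X$. Let $\Phi$ be a one-hot feature mapping with scalar features $\psi_1,\dots,\psi_K\in\mathcal F$, which may be chosen depending on the training samples: the components of $\Phi(x,y)$ are $\mathbb I\{y=j\}\psi_l(x)$ for $j\in\mathcal Y$ and $l=1,\dots,K$, and $j(i)$ denotes the label $j$ of the $i$-th component. Let $\tau=\frac1n\sum_{t=1}^n\Phi(x_t,y_t)$, let $\upsilon_n^{(i)}=\frac1{n-1}\sum_{t=1}^n(\Phi(x_t,y_t)^{(i)}-\tau^{(i)})^2$ be the sample variances (for $n\ge 2$), and let $n_j$ be the number of samples with label $j$. Let $\delta>0$. A vector $\lambda$ (a function of the samples) is said to have coverage probability at least $1-\delta$ if $$\mathbb P\big\{|\mathbb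 E_{\mathrm p^*}\{\Phi\}^{(i)}-\tau^{(i)}|\le\lambda^{(i)}\text{ for all }i\big\}\ge 1-\delta ,$$ where, for data-dependent features, $\mathbb E_{\mathrm p^*}\{\Phi\}$ is taken over a fresh pair $(x,y)\sim\mathrm p^*$ with $\Phi$ fixed (if the choice of features is not measurable, the condition means that the complementary event has outer probability at most $\delta$). 1. If $|\mathcal F|<\infty$, then $\displaystyle\lambda^{(i)}=C\sqrt{\frac{2\log(2|\mathcal F||\mathcal Y|/\delta)}{n}}$ has coverage probability at least $1-\delta$. 2. If $|\mathcal F|<\infty$ and $n\ge2$, then $$\lambda^{(i)}=\sqrt{\frac{2\upsilon_n^{(i)}\log(4|\mathcal F||\mathcal Y|/\delta)}{n}}+\frac{14\,C\log(4|\mathcal F||\mathcal Y|/\delta)}{3(n-1)}$$ has coverage probability at least $1-\delta$. If moreover $C\ge\frac12$, so does $$\lambda^{(i)}=2C\sqrt{\frac{2\upsilon_n^{(i)}\log(4|\mathcal F||\mathcal Y|/\delta)}{n}}+\frac{14\,C\log(4|\mathcal F||\mathcal Y|/\delta)}{3(n-1)} .$$ 3. For $\mathcal F$ finite or infinite and a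 probability measure $\nu$ on $\mathcal X$, let $$\mathcal R_k^{\nu}(\mathcal F)=\mathbb E_{z_1,\dots,z_k\sim\nu}\,\mathbb E_{\varepsilon}\,\sup_{\psi\in\mathcal F}\frac1k\sum_{t=1}^k\varepsilon_t\psi(z_t)$$ be its Rademacher complexity, with $z_1,\dots,z_k$ i.i.d. from $\nu$ and $\varepsilon$ uniform on $\{-1,1\}^k$. Suppose that, for every label $j$ with $\mathrm p^*(y=j)>0$ and with $\nu=\mathrm p^*_{x|y=j}$ the conditional distribution of the instance given label $j$, $\mathcal R_k^{\nu}(\mathcal F)\le R/\sqrt k$ for all $1\le k\le n$, and the usual measurability convention holds that $(z_1,\dots,z_k)\mapsto\sup_{\psi\in\mathcal F}\big(c\,\mathbb E_\nu\{\psi\}+\sum_{t=1}^k a_t\psi(z_t)\big)$ is measurable for all $k$, $a\in\mathbb R^k$, $c\in\mathbb R$ (automatic if $\mathcal F$ is countable). Then $$\lambda^{(i)}=2\sqrt{\frac{n_{j(i)}}{n}}\,\frac{R}{\sqrt n}+C\left(1+2\sqrt{\frac{n_{j(i)}}{n}}\right)\sqrt{\frac{\log(4|\mathcal Y|/\delta)}{2n}}$$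 has coverage probability at least $1-\delta$. -/

import Mathlib

open MeasureTheory ProbabilityTheory

noncomputable section

/-- One-hot feature mapping `Φ(x, y) = e_y ⊗ Ψ(x)` built from the scalar features
`Ψ = (ψ_1, …, ψ_K)`. The component `(j, l)` is `𝕀{y = j} ψ_l(x)`, so there are `|Y| K` of them. -/
def oneHotFeature {X Y : Type*} [DecidableEq Y] {K : ℕ} (Ψ : Fin K → X → ℝ) :
    X × Y → Y × Fin K → ℝ :=
  fun z i => if z.2 = i.1 then Ψ i.2 z.1 else 0

/-- The mean vector `τ_n`: sample average of the feature mapping. -/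
def sampleMean {Z ι : Type*} {n : ℕ} (Φ : Z → ι → ℝ) (s : Fin n → Z) : ι → ℝ :=
  fun i => (1 / (n : ℝ)) * ∑ t, Φ (s t) i

/-- The (unbiased) sample variance of each component of the feature mapping. -/
def sampleVariance {Z ι : Type*} {n : ℕ} (Φ : Z → ι → ℝ) (s : Fin n → Z) : ι → ℝ :=
  fun i => (1 / ((n : ℝ) - 1)) * ∑ t, (Φ (s t) i - sampleMean Φ s i) ^ 2

/-- The number `n_j` of samples with label `j`. -/
def labelCount {X Y : Type*} [DecidableEq Y] {n : ℕ} (s : Fin n → X × Y) (j : Y) : ℕ :=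
  (Finset.univ.filter fun t => (s t).2 = j).card

/-- The confidence vector `lam`, a function of the training samples, has coverage probability at
least `1 - δ` for `n` i.i.d. samples from `p`: the event that `|E_p Φ - τ_n| ≤ lam` fails in some
component has (outer) probability at most `δ`. The feature mapping `Φ` may depend on the training
samples `s`; the expectation of `Φ s` is then over a fresh instance-label pair. Bounding the outer
measure of the failure event gives `P(coverage) ≥ 1 - δ`, and does not need the selection
`s ↦ Φ s` to be measurable. -/
def HasCoverage {Z ι : Type*} [MeasurableSpace Z] {n : ℕ} (p : Measure Z)
    (Φ : (Fin n → Z) → Z → ι → ℝ) (lam : (Fin n → Z) → ι → ℝ) (δ : ℝ) : Prop :=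
  (Measure.pi fun _ : Fin n => p)
      {s | ¬ ∀ i, |(∫ z, Φ s z i ∂p) - sampleMean (Φ s) s i| ≤ lam s i} ≤ ENNReal.ofReal δ

/-- The conditional distribution `p_{x|y=j}` of the instance given the label `j`. -/
def condInstance {X Y : Type*} [MeasurableSpace X] [MeasurableSpace Y]
    (p : Measure (X × Y)) (j : Y) : Measure X :=
  (ProbabilityTheory.cond p (Prod.snd ⁻¹' {j})).map Prod.fst

/-- The Rademacher complexity
`R_k(F) = E_{x_1,…,x_k ∼ ν} E_ε sup_{ψ ∈ F} (1/k) ∑ ε_i ψ(x_i)`, where `ε` is uniform on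
`{1, -1}^k` (written as `Fin k → ℤˣ`). -/
def rademacherComplexity {X : Type*} [MeasurableSpace X] (ν : Measure X) (F : Set (X → ℝ))
    (k : ℕ) : ℝ :=
  ∫ x : Fin k → X, (1 / (2 : ℝ) ^ k) * ∑ ε : Fin k → ℤˣ,
      ⨆ ψ : F, (1 / (k : ℝ)) * ∑ i, ((ε i : ℤ) : ℝ) * (ψ : X → ℝ) (x i)
    ∂(Measure.pi fun _ : Fin k => ν)

/-- The usual measurability convention for empirical processes indexed by a possibly uncountable
family: the suprema over `F` of linear combinations of evaluations and of the expectation are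
measurable functions of the sample. Automatic for countable families of bounded measurable
functions. -/
def HasMeasurableSuprema {X : Type*} [MeasurableSpace X] (ν : Measure X)
    (F : Set (X → ℝ)) : Prop :=
  ∀ (k : ℕ) (a : Fin k → ℝ) (c : ℝ),
    Measurable fun x : Fin k → X =>
      ⨆ ψ : F, (c * (∫ u, (ψ : X → ℝ) u ∂ν) + ∑ i, a i * (ψ : X → ℝ) (x i))

end

/-! ### Sub-Gaussian and Chernoff tails, and elementary bounds on the exponential -/

section TailBounds

variable {Ω Z : Type*} [MeasurableSpace Ω] [MeasurableSpace Z]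

/-! The features may depend on the samples, so each failure event is covered by finitely many events
fixed before sampling (`hasCoverage_of_cover`). Subadditivity of outer measure then needs no
measurability of the selection.

For finite `F` the cover is indexed by `F × Y`. Hoeffding costs `2 exp (-L)` per pair. For the
variance version, Bernstein in both directions (`bernstein_sampleMean`) gives a bound with the true
variance, and `sqrt_sampleVariance_lower_tail` replaces the true standard deviation by the empirical
one, for `3 exp (-L)` in all. That tail comes from decoupling: the sample variance is an average
over permutations of means of independent terms `(x - y) ^ 2 / 2`, so Jensen's inequality reduces
its exponential moment to the independent case.

For general `F` the cover is indexed by labels only. Given all labels, the instances with label `j`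
are i.i.d. from the conditional law and their number `N` is fixed. Symmetrization
(`integral_deviationSup_le`) and McDiarmid (`hasSubgaussianMGF_of_bounded_differences`) then bound
the deviation uniformly over `F` by `2 R_N + 2 C √(L / (2 N))`. With `q` the label probability, `E`
the conditional mean and `M` the conditional average, the error is `q E - (N / n) M = (q - N / n) E
+ (N / n) (E - M)`. Hoeffding controls the first term, and the weight `N / n` turns the rate `1 /
√N` into `√(N / n) / √n`. -/

theorem integrable_of_abs_le {μ : Measure Ω} [IsFiniteMeasure μ] {f : Ω → ℝ} {B : ℝ}
    (hf : Measurable f) (hB : ∀ ω, |f ω| ≤ B) : Integrable f μ :=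
  Integrable.of_bound hf.aestronglyMeasurable B (Filter.Eventually.of_forall hB)

/-- Tail bound for a sub-Gaussian variable, at deviation level `√(2 c L)`. -/
theorem measure_sqrt_lt_le_of_hasSubgaussianMGF {μ : Measure Ω} [IsProbabilityMeasure μ]
    {X : Ω → ℝ} {c : NNReal} (h : HasSubgaussianMGF X c μ) {L : ℝ} (hL : 0 ≤ L) :
    μ {ω | √(2 * c * L) < X ω} ≤ ENNReal.ofReal (Real.exp (-L)) := by
  rcases eq_or_ne c 0 with rfl | hc
  -- The Chernoff exponent divides by `c`; with `c = 0` the variable vanishes almost surely.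
  · have h0 : μ {ω | √(2 * ((0 : NNReal) : ℝ) * L) < X ω} = 0 := by
      rw [measure_eq_zero_iff_ae_notMem]
      filter_upwards [h.ae_eq_zero_of_hasSubgaussianMGF_zero] with ω hω
      simp [hω]
    rw [h0]; exact zero_le
  · have hc' : (0 : ℝ) < c := by positivity
    have h1 := h.measure_ge_le (Real.sqrt_nonneg (2 * c * L))
    rw [Real.sq_sqrt (by positivity), show -(2 * c * L) / (2 * (c : ℝ)) = -L by field_simp] at h1
    have h2 : {ω | √(2 * c * L) < X ω} ⊆ {ω | √(2 * c * L) ≤ X ω} := fun ω hω => by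
      simp only [Set.mem_ofPred_eq] at hω ⊢
      exact hω.le
    refine (measure_mono h2).trans ?_
    rw [← ofReal_measureReal (measure_ne_top _ _)]
    exact ENNReal.ofReal_le_ofReal h1

/-- Chernoff's bound: an exponential moment bound gives an exponential tail bound. -/
theorem measure_add_le_le_of_integral_exp_le {μ : Measure Ω} [IsProbabilityMeasure μ]
    {f : Ω → ℝ} (hint : Integrable (fun ω => Real.exp (f ω)) μ) {B L : ℝ}
    (hB : ∫ ω, Real.exp (f ω) ∂μ ≤ Real.exp B) :
    μ {ω | B + L ≤ f ω} ≤ ENNReal.ofReal (Real.exp (-L)) := by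
  have h1 := measure_ge_le_exp_mul_mgf (μ := μ) (X := f) (B + L) (zero_le_one (α := ℝ))
    (by simpa using hint)
  rw [← ofReal_measureReal (measure_ne_top _ _)]
  refine ENNReal.ofReal_le_ofReal (h1.trans ?_)
  have h2 : mgf f μ 1 ≤ Real.exp B := by simpa [mgf] using hB
  calc Real.exp (-1 * (B + L)) * mgf f μ 1 ≤ Real.exp (-1 * (B + L)) * Real.exp B := by gcongr
    _ = Real.exp (-L) := by rw [← Real.exp_add]; ring_nf

/-- **Hoeffding's inequality** for the sample mean of a bounded function. -/
theorem hoeffding_sampleMean (μ : Measure Z) [IsProbabilityMeasure μ] {f : Z → ℝ}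
    (hf : Measurable f) {a b : ℝ} (hab : ∀ z, f z ∈ Set.Icc a b) {n : ℕ} (hn : 1 ≤ n) {L : ℝ}
    (hL : 0 ≤ L) :
    (Measure.pi fun _ : Fin n => μ)
      {s | (b - a) * √(L / (2 * n)) < (1 / (n : ℝ)) * ∑ t, f (s t) - ∫ z, f z ∂μ}
      ≤ ENNReal.ofReal (Real.exp (-L)) := by
  have hn0 : (0 : ℝ) < n := by exact_mod_cast hn
  obtain ⟨z0⟩ : Nonempty Z := nonempty_of_isProbabilityMeasure μ
  have hba : a ≤ b := (hab z0).1.trans (hab z0).2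
  have hS := HasSubgaussianMGF.sum_of_iIndepFun (s := Finset.univ)
    (c := fun _ : Fin n => (‖b - a‖₊ / 2) ^ 2)
    (X := fun (t : Fin n) (s : Fin n → Z) => f (s t) - ∫ z, f z ∂μ)
    (μ := Measure.pi fun _ : Fin n => μ)
    (iIndepFun_pi (X := fun _ z => f z - ∫ z, f z ∂μ) fun _ => by fun_prop)
    (fun t _ => by
      have h1 := hasSubgaussianMGF_of_mem_Icc (μ := μ) hf.aemeasurable
        (Filter.Eventually.of_forall hab)
      refine HasSubgaussianMGF.of_map (Y := fun s : Fin n → Z => s t)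
        (X := fun z => f z - ∫ z, f z ∂μ) (measurable_pi_apply t).aemeasurable ?_
      rwa [(measurePreserving_eval (fun _ : Fin n => μ) t).map_eq])
  refine (measure_mono ?_).trans (measure_sqrt_lt_le_of_hasSubgaussianMGF hS hL)
  intro s hs
  simp only [Set.mem_ofPred_eq] at hs ⊢
  have h2 : √(2 * ((∑ _t : Fin n, (‖b - a‖₊ / 2) ^ 2 : NNReal) : ℝ) * L)
      = n * ((b - a) * √(L / (2 * n))) := by
    rw [← Real.sqrt_sq (show 0 ≤ n * ((b - a) * √(L / (2 * n))) by
      have := sub_nonneg.2 hba; positivity)]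
    congr 1
    rw [mul_pow, mul_pow, Real.sq_sqrt (by positivity)]
    simp only [div_pow, Finset.sum_const, Finset.card_univ, Fintype.card_fin, nsmul_eq_mul,
      NNReal.coe_mul, NNReal.coe_natCast, NNReal.coe_div, NNReal.coe_pow, coe_nnnorm,
      Real.norm_eq_abs, sq_abs, NNReal.coe_ofNat]
    field_simp
  rw [h2, Finset.sum_sub_distrib]
  have h3 := mul_lt_mul_of_pos_left hs hn0
  refine h3.trans_eq ?_
  simp
  field_simp

/-- The difference of the two sides vanishes at `0` and has derivative `1 + y - exp y ≤ 0`. -/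
theorem exp_le_one_add_add_sq_half_of_nonpos {x : ℝ} (hx : x ≤ 0) :
    Real.exp x ≤ 1 + x + x ^ 2 / 2 := by
  have hd : ∀ y : ℝ, HasDerivAt (fun y : ℝ => 1 + y + y ^ 2 / 2 - Real.exp y)
      (1 + y - Real.exp y) y := fun y => by
    have h := ((((hasDerivAt_id y).const_add 1).add (((hasDerivAt_id y).pow 2).div_const 2)).sub
      (Real.hasDerivAt_exp y))
    convert! h using 1
    simp
  have hanti : Antitone (fun y : ℝ => 1 + y + y ^ 2 / 2 - Real.exp y) :=
    antitone_of_deriv_nonpos (fun y => (hd y).differentiableAt) fun y => by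
      rw [(hd y).deriv]; linarith [Real.add_one_le_exp y]
  have := hanti hx
  simp at this
  linarith

/-- After division by `exp x` the difference of the sides vanishes at `0`, and its derivative has
the sign of `exp y - (1 + y + y ^ 2 / 2)`, which is the sign of `y`. So `0` is a global minimum. -/
theorem exp_mul_le_quadratic (x : ℝ) :
    Real.exp x * (6 - 2 * x) ≤ 6 + 4 * x + x ^ 2 := by
  set g : ℝ → ℝ := fun y => Real.exp (-y) * (6 + 4 * y + y ^ 2) - (6 - 2 * y) with hg
  have hd : ∀ y : ℝ, HasDerivAt g (2 * Real.exp (-y) * (Real.exp y - (1 + y + y ^ 2 / 2))) y := by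
    intro y
    have h := (((Real.hasDerivAt_exp (-y)).comp y (hasDerivAt_neg y)).mul
      ((((hasDerivAt_id y).const_mul 4).const_add 6).add ((hasDerivAt_id y).pow 2))).sub
      (((hasDerivAt_id y).const_mul 2).const_sub 6)
    convert! h using 1
    have : Real.exp (-y) * Real.exp y = 1 := by rw [← Real.exp_add]; simp
    simp
    linear_combination 2 * this
  have hc : ∀ s, ContinuousOn g s := fun s y _ => (hd y).continuousAt.continuousWithinAt
  have key : 0 ≤ g x := by
    have h0 : g 0 = 0 := by simp [hg]
    rcases le_total 0 x with hx | hx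
    · have hm : MonotoneOn g (Set.Ici 0) := by
        refine monotoneOn_of_deriv_nonneg (convex_Ici 0) (hc _)
          (fun y _ => (hd y).differentiableAt.differentiableWithinAt) fun y hy => ?_
        rw [interior_Ici, Set.mem_Ioi] at hy
        rw [(hd y).deriv]
        have := Real.quadratic_le_exp_of_nonneg hy.le
        have := sub_nonneg.2 this
        positivity
      rw [← h0]
      exact hm Set.self_mem_Ici hx hx
    · have hm : AntitoneOn g (Set.Iic 0) := by
        refine antitoneOn_of_deriv_nonpos (convex_Iic 0) (hc _)
          (fun y _ => (hd y).differentiableAt.differentiableWithinAt) fun y hy => ?_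
        rw [interior_Iic, Set.mem_Iio] at hy
        rw [(hd y).deriv]
        exact mul_nonpos_of_nonneg_of_nonpos (by positivity)
          (sub_nonpos.2 (exp_le_one_add_add_sq_half_of_nonpos hy.le))
      rw [← h0]
      exact hm hx Set.self_mem_Iic hx
  have h1 : Real.exp x * Real.exp (-x) = 1 := by rw [← Real.exp_add]; simp
  have h2 := mul_nonneg (Real.exp_pos x).le key
  simp only [hg] at h2
  linear_combination h2 + (6 + 4 * x + x ^ 2) * h1

/-- If `x ≤ y < 3` then `exp x ≤ 1 + x + x ^ 2 / (2 (1 - y / 3))`. -/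
theorem exp_le_one_add_add_sq_div {x y : ℝ} (hxy : x ≤ y) (hy : y < 3) :
    Real.exp x ≤ 1 + x + x ^ 2 / (2 * (1 - y / 3)) := by
  have h1 : Real.exp x ≤ 1 + x + x ^ 2 / (2 * (1 - x / 3)) := by
    have h2 : 0 < 1 - x / 3 := by linarith
    have h3 := exp_mul_le_quadratic x
    have h4 : 1 + x + x ^ 2 / (2 * (1 - x / 3)) = (6 + 4 * x + x ^ 2) / (6 - 2 * x) := by
      obtain ⟨u, rfl⟩ : ∃ u, x = 3 - u := ⟨3 - x, by ring⟩
      have hu : u ≠ 0 := by rintro rfl; norm_num at h2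
      rw [show 1 - (3 - u) / 3 = u / 3 by ring, show 6 - 2 * (3 - u) = 2 * u by ring]
      field_simp
      ring
    rw [h4, le_div_iff₀ (by linarith)]
    exact h3
  refine h1.trans ?_
  have : 0 < 1 - y / 3 := by linarith
  gcongr

end TailBounds

/-! ### Bernstein's inequality -/

section Bernstein

variable {Z : Type*} [MeasurableSpace Z]

theorem integral_exp_sum_pi (μ : Measure Z) [IsProbabilityMeasure μ] (n : ℕ) (g : Z → ℝ) :
    ∫ s, Real.exp (∑ t, g (s t)) ∂(Measure.pi fun _ : Fin n => μ)
      = (∫ z, Real.exp (g z) ∂μ) ^ n := by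
  simp_rw [Real.exp_sum]
  simpa using integral_fintype_prod_eq_pow (μ := μ) (ι := Fin n) (fun z => Real.exp (g z))

theorem integrable_exp_of_abs_le {μ : Measure Z} [IsFiniteMeasure μ] {f : Z → ℝ} {B : ℝ}
    (hf : Measurable f) (hB : ∀ ω, |f ω| ≤ B) : Integrable (fun z => Real.exp (f z)) μ :=
  integrable_of_abs_le (B := Real.exp B) (by fun_prop) fun ω => by
    rw [Real.abs_exp]; exact Real.exp_le_exp.2 ((le_abs_self _).trans (hB ω))

/-- The exponential moment estimate behind Bernstein's inequality. -/
theorem integral_exp_mul_le_of_abs_le {μ : Measure Z} [IsProbabilityMeasure μ] {X : Z → ℝ}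
    (hX : Measurable X) {b : ℝ} (hb : ∀ z, |X z| ≤ b) (h0 : ∫ z, X z ∂μ = 0) {r : ℝ}
    (hr : 0 ≤ r) (hrb : r * b < 3) :
    ∫ z, Real.exp (r * X z) ∂μ
      ≤ Real.exp (r ^ 2 * (∫ z, X z ^ 2 ∂μ) / (2 * (1 - r * b / 3))) := by
  have hXi : Integrable X μ := integrable_of_abs_le hX hb
  have hX2 : Integrable (fun z => X z ^ 2) μ :=
    integrable_of_abs_le (B := b ^ 2) (by fun_prop) fun z => by
      rw [abs_pow]; gcongr; exact hb z
  have h1 : ∫ z, Real.exp (r * X z) ∂μ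
      ≤ ∫ z, (1 + r * X z + r ^ 2 / (2 * (1 - r * b / 3)) * X z ^ 2) ∂μ := by
    refine integral_mono
      (integrable_exp_of_abs_le (B := r * b) (by fun_prop) fun z => ?_)
      (((integrable_const _).add (hXi.const_mul r)).add (hX2.const_mul _)) fun z => ?_
    · rw [abs_mul, abs_of_nonneg hr]; gcongr; exact hb z
    · refine (exp_le_one_add_add_sq_div
        (mul_le_mul_of_nonneg_left ((le_abs_self _).trans (hb z)) hr) hrb).trans_eq ?_
      ring
  refine h1.trans ?_
  rw [integral_add (by fun_prop) (by fun_prop), integral_add (by fun_prop) (by fun_prop),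
    integral_const_mul, integral_const_mul, h0]
  simp only [integral_const, probReal_univ, smul_eq_mul, mul_zero, add_zero, mul_one]
  refine (le_of_eq ?_).trans (Real.add_one_le_exp _)
  ring

/-- **Bernstein's inequality** for the sample mean of a bounded function. -/
theorem bernstein_sampleMean (μ : Measure Z) [IsProbabilityMeasure μ] {f : Z → ℝ}
    (hf : Measurable f) {b : ℝ} (hb : ∀ z, |f z - ∫ w, f w ∂μ| ≤ b) {n : ℕ} (hn : 1 ≤ n) {L : ℝ}
    (hL : 0 ≤ L) :
    (Measure.pi fun _ : Fin n => μ)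
      {s | √(2 * (∫ z, (f z - ∫ w, f w ∂μ) ^ 2 ∂μ) * L / n) + b * L / (3 * n)
        < (1 / (n : ℝ)) * ∑ t, f (s t) - ∫ z, f z ∂μ}
      ≤ ENNReal.ofReal (Real.exp (-L)) := by
  have hn0 : (0 : ℝ) < n := by exact_mod_cast hn
  obtain ⟨z0⟩ : Nonempty Z := nonempty_of_isProbabilityMeasure μ
  have hb0 : 0 ≤ b := (abs_nonneg _).trans (hb z0)
  set m := ∫ w, f w ∂μ with hm
  set v := ∫ z, (f z - m) ^ 2 ∂μ with hv
  set X : Z → ℝ := fun z => f z - m with hX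
  have hXm : Measurable X := by fun_prop
  have hsum : ∀ s : Fin n → Z, (1 / (n : ℝ)) * ∑ t, f (s t) - m = (∑ t, X (s t)) / n := by
    intro s
    simp only [hX, Finset.sum_sub_distrib]
    simp
    field_simp
  have hX0 : ∫ z, X z ∂μ = 0 := by
    have hfi : Integrable f μ := integrable_of_abs_le (B := b + |m|) hf fun z => by
      have h1 := hb z
      have h2 := abs_sub_abs_le_abs_sub (f z) m
      linarith
    rw [hX, integral_sub hfi (integrable_const _)]
    simp [hm]
  have hv0 : 0 ≤ v := integral_nonneg fun z => sq_nonneg _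
  have hX2 : Integrable (fun z => X z ^ 2) μ :=
    integrable_of_abs_le (B := b ^ 2) (by fun_prop) fun z => by
      rw [abs_pow]; gcongr; exact hb z
  -- The parameter `σ` below divides by `L` and must be positive. This excludes `L = 0`, where the
  -- bound is `1`, and zero variance, where `f` is almost surely constant.
  rcases hL.eq_or_lt with rfl | hL
  · simpa using prob_le_one
  rcases hv0.eq_or_lt with hv0 | hv0
  · have h1 : ∀ᵐ z ∂μ, X z = 0 := by
      have := (integral_eq_zero_iff_of_nonneg (fun z => sq_nonneg (X z)) hX2).1 hv0.symm
      filter_upwards [this] with z hz using by simpa using hz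
    have h2 : ∀ᵐ s ∂(Measure.pi fun _ : Fin n => μ), ∀ t, X (s t) = 0 :=
      ae_all_iff.2 fun t =>
        (measurePreserving_eval (fun _ : Fin n => μ) t).quasiMeasurePreserving.ae h1
    refine le_of_eq_of_le ?_ zero_le
    rw [measure_eq_zero_iff_ae_notMem]
    filter_upwards [h2] with s hs
    simp only [hsum, hs, ← hv0]
    simp
    positivity
  -- With `r = 1 / (b / 3 + σ)` one has `1 - r b / 3 = r σ`, so the moment exponent collapses to `n
  -- r v / (2 σ) = L σ r`. Adding `L = L r (b / 3 + σ)` gives exactly `r` times the threshold `2 L σ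
  -- + b L / 3` for the sum.
  · set σ := √(n * v / (2 * L)) with hσ
    have hσ0 : 0 < σ := Real.sqrt_pos.2 (by positivity)
    have hσ2 : σ ^ 2 * (2 * L) = n * v := by
      rw [hσ, Real.sq_sqrt (by positivity)]; field_simp
    set r := 1 / (b / 3 + σ) with hr
    have hr0 : 0 < r := by positivity
    have hrσ : r * (b / 3 + σ) = 1 := by rw [hr]; field_simp
    have hrb : r * b < 3 := by nlinarith [mul_pos hr0 hσ0]
    have hmgf := integral_exp_mul_le_of_abs_le (μ := μ) hXm hb hX0 hr0.le hrb
    have hB : ∫ s, Real.exp (∑ t, r * X (s t)) ∂(Measure.pi fun _ : Fin n => μ)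
        ≤ Real.exp (L * σ * r) := by
      rw [integral_exp_sum_pi μ n (fun z => r * X z)]
      refine (pow_le_pow_left₀ (integral_nonneg fun _ => (Real.exp_pos _).le) hmgf n).trans ?_
      rw [← Real.exp_nat_mul]
      refine Real.exp_le_exp.2 (le_of_eq ?_)
      rw [show 1 - r * b / 3 = r * σ by linarith]
      have : (∫ z, X z ^ 2 ∂μ) = v := rfl
      rw [this]
      field_simp
      linarith
    have hint : Integrable (fun s : Fin n → Z => Real.exp (∑ t, r * X (s t)))
        (Measure.pi fun _ : Fin n => μ) :=
      integrable_exp_of_abs_le (B := ∑ _t : Fin n, r * b)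
        (Finset.measurable_sum _ fun t _ => (hXm.comp (measurable_pi_apply t)).const_mul r)
        fun s => (Finset.abs_sum_le_sum_abs _ _).trans (Finset.sum_le_sum fun t _ => by
          rw [abs_mul, abs_of_pos hr0]; gcongr; exact hb _)
    refine (measure_mono fun s hs => ?_).trans (measure_add_le_le_of_integral_exp_le hint hB)
    simp only [Set.mem_ofPred_eq, hsum] at hs ⊢
    have h3 : √(2 * v * L / n) = 2 * L * σ / n := by
      rw [← Real.sqrt_sq (show 0 ≤ 2 * L * σ / n by positivity)]
      congr 1
      field_simp
      linear_combination -hσ2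
    rw [h3, show 2 * L * σ / n + b * L / (3 * n) = (2 * L * σ + b / 3 * L) / n by field_simp,
      div_lt_div_iff_of_pos_right hn0] at hs
    rw [← Finset.mul_sum]
    have h4 := mul_lt_mul_of_pos_left hs hr0
    clear_value r
    linear_combination h4.le - L * hrσ

end Bernstein

/-! ### Decoupling the sample variance into disjoint pairs -/

section Decoupling

/-- The symmetric group is doubly transitive: one transposition places `a'`, and a second, which
avoids `a`, corrects the image of `b'`. -/
theorem exists_perm_apply_eq_apply_eq {ι : Type*} [DecidableEq ι] {a b a' b' : ι} (h : a ≠ b)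
    (h' : a' ≠ b') : ∃ τ : Equiv.Perm ι, τ a' = a ∧ τ b' = b := by
  refine ⟨Equiv.swap b (Equiv.swap a' a b') * Equiv.swap a' a, ?_, ?_⟩
  · rw [Equiv.Perm.mul_apply, Equiv.swap_apply_left]
    refine Equiv.swap_apply_of_ne_of_ne h fun h1 => h' ?_
    apply (Equiv.swap a' a).injective
    rw [Equiv.swap_apply_left, ← h1]
  · rw [Equiv.Perm.mul_apply, Equiv.swap_apply_right]

/-- The average over all permutations of a function of two distinct positions is the average over
all pairs of distinct positions. -/
theorem card_mul_sum_perm_apply_apply {ι : Type*} [Fintype ι] [DecidableEq ι] (g : ι → ι → ℝ)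
    (hg : ∀ i, g i i = 0) {a b : ι} (hab : a ≠ b) :
    ((Fintype.card ι : ℝ) * (Fintype.card ι - 1)) * ∑ σ : Equiv.Perm ι, g (σ a) (σ b)
      = (Fintype.card (Equiv.Perm ι) : ℝ) * ∑ i, ∑ j, g i j := by
  -- Right translation in the group makes the permutation sum the same for every pair of distinct
  -- positions. The triple sum is then counted in two orders.
  have h1 : ∀ i j, i ≠ j →
      ∑ σ : Equiv.Perm ι, g (σ i) (σ j) = ∑ σ : Equiv.Perm ι, g (σ a) (σ b) := by
    intro i j hij
    obtain ⟨τ, rfl, rfl⟩ := exists_perm_apply_eq_apply_eq hij hab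
    exact Equiv.sum_comp (Equiv.mulRight τ) fun σ => g (σ a) (σ b)
  have h2 : ∑ i, ∑ j, ∑ σ : Equiv.Perm ι, g (σ i) (σ j)
      = ((Fintype.card ι : ℝ) * (Fintype.card ι - 1)) * ∑ σ : Equiv.Perm ι, g (σ a) (σ b) := by
    have h3 : ∀ i, ∑ j, ∑ σ : Equiv.Perm ι, g (σ i) (σ j)
        = ((Fintype.card ι : ℝ) - 1) * ∑ σ : Equiv.Perm ι, g (σ a) (σ b) := by
      intro i
      rw [← Finset.sum_erase (a := i) Finset.univ (by simp [hg]),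
        Finset.sum_congr rfl fun j hj => h1 i j (Finset.ne_of_mem_erase hj).symm,
        Finset.sum_const, Finset.card_erase_of_mem (Finset.mem_univ i), Finset.card_univ,
        nsmul_eq_mul, Nat.cast_sub (Fintype.card_pos_iff.2 ⟨i⟩), Nat.cast_one]
    simp_rw [h3]
    rw [Finset.sum_const, Finset.card_univ, nsmul_eq_mul, mul_assoc]
  rw [← h2]
  have h4 : ∀ i, ∑ j, ∑ σ : Equiv.Perm ι, g (σ i) (σ j)
      = ∑ σ : Equiv.Perm ι, ∑ j, g (σ i) (σ j) := fun i => Finset.sum_comm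
  simp_rw [h4]
  rw [Finset.sum_comm]
  have h5 : ∀ σ : Equiv.Perm ι, ∑ i, ∑ j, g (σ i) (σ j) = ∑ i, ∑ j, g i j := by
    intro σ
    rw [← Equiv.sum_comp σ fun i => ∑ j, g i j]
    exact Finset.sum_congr rfl fun i _ => Equiv.sum_comp σ fun j => g (σ i) j
  simp_rw [h5]
  rw [Finset.sum_const, Finset.card_univ, nsmul_eq_mul]

theorem sum_sub_mean_sq_eq {n : ℕ} (hn : 1 ≤ n) (x : Fin n → ℝ) :
    ∑ t, (x t - (1 / (n : ℝ)) * ∑ u, x u) ^ 2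
      = (1 / (n : ℝ)) * ∑ i, ∑ j, (x i - x j) ^ 2 / 2 := by
  have hn0 : (n : ℝ) ≠ 0 := by positivity
  have h1 : ∀ i, ∑ j, (x i - x j) ^ 2 / 2
      = (n * x i ^ 2 - 2 * (∑ u, x u) * x i + ∑ u, x u ^ 2) / 2 := by
    intro i
    rw [← Finset.sum_div]
    congr 1
    simp only [sub_sq, Finset.sum_add_distrib, Finset.sum_sub_distrib, ← Finset.mul_sum]
    simp
    ring
  have h2 : ∀ m : ℝ, ∑ t, (x t - m) ^ 2 = ∑ u, x u ^ 2 - 2 * (∑ u, x u) * m + n * m ^ 2 := by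
    intro m
    simp only [sub_sq, Finset.sum_add_distrib, Finset.sum_sub_distrib, ← Finset.mul_sum,
      ← Finset.sum_mul]
    simp
  simp_rw [h1, h2]
  rw [← Finset.sum_div, Finset.sum_add_distrib, Finset.sum_sub_distrib, ← Finset.mul_sum,
    ← Finset.mul_sum]
  simp only [Finset.sum_const, Finset.card_univ, Fintype.card_fin, nsmul_eq_mul]
  field_simp
  ring

/-- The positions of the `m` disjoint pairs `(k, m + k)` among `n ≥ 2 m` positions. -/
def pairPosition {m n : ℕ} (h : 2 * m ≤ n) : Fin m ⊕ Fin m → Fin n :=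
  Sum.elim (fun k => ⟨k, by omega⟩) (fun k => ⟨m + k, by omega⟩)

theorem pairPosition_injective {m n : ℕ} (h : 2 * m ≤ n) :
    Function.Injective (pairPosition h) := by
  rintro (i | i) (j | j) hij <;> simp [pairPosition, Fin.ext_iff] at hij ⊢ <;> omega

/-- Hoeffding's representation of the sample variance as an average over permutations of means
over disjoint pairs. -/
theorem sampleVariance_eq_sum_perm {n m : ℕ} (hm : 1 ≤ m) (h : 2 * m ≤ n) (x : Fin n → ℝ) :
    (1 / ((n : ℝ) - 1)) * ∑ t, (x t - (1 / (n : ℝ)) * ∑ u, x u) ^ 2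
      = ∑ σ : Equiv.Perm (Fin n), (1 / (Fintype.card (Equiv.Perm (Fin n)) : ℝ)) *
          ((1 / (m : ℝ)) * ∑ k : Fin m, (x (σ (pairPosition h (Sum.inl k)))
            - x (σ (pairPosition h (Sum.inr k)))) ^ 2 / 2) := by
  have hn0 : (0 : ℝ) < n := by exact_mod_cast (by omega : 0 < n)
  have hn1 : (0 : ℝ) < n - 1 := by
    have : (2 : ℝ) ≤ n := by exact_mod_cast (by omega : 2 ≤ n)
    linarith
  have hm0 : (0 : ℝ) < m := by exact_mod_cast hm
  have hN : (0 : ℝ) < Fintype.card (Equiv.Perm (Fin n)) := by exact_mod_cast Fintype.card_pos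
  rw [sum_sub_mean_sq_eq (by omega), ← Finset.mul_sum, ← Finset.mul_sum,
    Finset.sum_comm (s := Finset.univ (α := Equiv.Perm (Fin n)))]
  have h1 : ∀ k : Fin m, ∑ σ : Equiv.Perm (Fin n), (x (σ (pairPosition h (Sum.inl k)))
      - x (σ (pairPosition h (Sum.inr k)))) ^ 2 / 2
      = (Fintype.card (Equiv.Perm (Fin n)) : ℝ) / (n * (n - 1)) *
        ∑ i, ∑ j, (x i - x j) ^ 2 / 2 := by
    intro k
    have := card_mul_sum_perm_apply_apply (fun i j => (x i - x j) ^ 2 / 2) (by simp)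
      ((pairPosition_injective h).ne (by simp : Sum.inl k ≠ Sum.inr k))
    rw [Fintype.card_fin] at this
    rw [div_mul_eq_mul_div, eq_div_iff (by positivity), mul_comm]
    exact this
  simp_rw [h1]
  rw [Finset.sum_const, Finset.card_univ, Fintype.card_fin, nsmul_eq_mul]
  field_simp

variable {Z : Type*} [MeasurableSpace Z]

/-- Samples read at distinct positions are again i.i.d.; this makes the terms over disjoint pairs
independent for each fixed permutation. -/
theorem measurePreserving_comp_injective (μ : Measure Z) [IsProbabilityMeasure μ]
    {ι κ : Type*} [Fintype ι] [Fintype κ] {e : ι → κ} (he : Function.Injective e) :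
    MeasurePreserving (fun (s : κ → Z) i => s (e i)) (Measure.pi fun _ : κ => μ)
      (Measure.pi fun _ : ι => μ) := by
  refine ⟨by fun_prop, ?_⟩
  have h1 := (iIndepFun_pi (μ := fun _ : κ => μ) (X := fun _ z => z)
    fun _ => aemeasurable_id).precomp he
  rw [iIndepFun_iff_map_fun_eq_pi_map (fun i => (measurable_pi_apply (e i)).aemeasurable)] at h1
  rw [h1]
  congr 1
  ext1 i
  exact (measurePreserving_eval (fun _ : κ => μ) (e i)).map_eq

theorem measurePreserving_pairs (μ : Measure Z) [IsProbabilityMeasure μ] {n m : ℕ}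
    {e : Fin m ⊕ Fin m → Fin n} (he : Function.Injective e) :
    MeasurePreserving (fun (s : Fin n → Z) k => (s (e (Sum.inl k)), s (e (Sum.inr k))))
      (Measure.pi fun _ : Fin n => μ) (Measure.pi fun _ : Fin m => μ.prod μ) := by
  have h1 := measurePreserving_comp_injective μ he
  have h2 := (measurePreserving_sumPiEquivProdPi_symm (X := fun _ : Fin m ⊕ Fin m => Z)
    fun _ => μ).symm
  have h3 := (measurePreserving_arrowProdEquivProdArrow Z Z (Fin m) (fun _ => μ)
    (fun _ => μ)).symm
  exact h3.comp (h2.comp h1)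

end Decoupling

/-! ### Lower tail of the sample standard deviation -/

section EmpiricalVariance

variable {Z : Type*} [MeasurableSpace Z]

/-- After centring both copies at the mean, the cross term factors by independence and vanishes. -/
theorem integral_prod_half_sq_sub (μ : Measure Z) [IsProbabilityMeasure μ] {f : Z → ℝ}
    (hf : Measurable f) {B : ℝ} (hB : ∀ z, |f z| ≤ B) :
    ∫ q, (f q.1 - f q.2) ^ 2 / 2 ∂(μ.prod μ) = ∫ z, (f z - ∫ w, f w ∂μ) ^ 2 ∂μ := by
  set m := ∫ w, f w ∂μ with hm
  have hfi : Integrable f μ := integrable_of_abs_le hf hB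
  have hX : Integrable (fun z => f z - m) μ := hfi.sub (integrable_const m)
  have hX0 : ∫ z, (f z - m) ∂μ = 0 := by
    rw [integral_sub hfi (integrable_const _)]; simp [hm]
  have hX2 : Integrable (fun z => (f z - m) ^ 2) μ :=
    integrable_of_abs_le (B := (B + |m|) ^ 2) (by fun_prop) fun z => by
      rw [abs_pow]; gcongr; exact (abs_sub _ _).trans (by gcongr; exact hB z)
  have h1 : ∀ q : Z × Z, (f q.1 - f q.2) ^ 2 / 2
      = ((f q.1 - m) ^ 2 / 2 + (f q.2 - m) ^ 2 / 2) - (f q.1 - m) * (f q.2 - m) := fun q => by ring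
  simp_rw [h1]
  have i1 : Integrable (fun q : Z × Z => (f q.1 - m) ^ 2 / 2) (μ.prod μ) :=
    (hX2.div_const 2).comp_fst μ
  have i2 : Integrable (fun q : Z × Z => (f q.2 - m) ^ 2 / 2) (μ.prod μ) :=
    (hX2.div_const 2).comp_snd μ
  have i12 : Integrable (fun q : Z × Z => (f q.1 - m) ^ 2 / 2 + (f q.2 - m) ^ 2 / 2) (μ.prod μ) :=
    i1.add i2
  rw [integral_sub i12 (hX.mul_prod hX), integral_add i1 i2,
    integral_prod_mul (fun z => f z - m) (fun z => f z - m), hX0,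
    integral_fun_fst (fun z => (f z - m) ^ 2 / 2), integral_fun_snd (fun z => (f z - m) ^ 2 / 2),
    integral_div]
  simp

/-- Exponential moment of the negative sample variance, by decoupling into disjoint pairs. -/
theorem integral_exp_neg_sampleVariance_le (μ : Measure Z) [IsProbabilityMeasure μ] {f : Z → ℝ}
    (hf : Measurable f) {b : ℝ} (hb : ∀ z w, |f z - f w| ≤ b) {n m : ℕ} (hm : 1 ≤ m)
    (h : 2 * m ≤ n) {l : ℝ} (hl : 0 ≤ l) :
    ∫ s, Real.exp (-l * ((1 / ((n : ℝ) - 1)) *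
        ∑ t, (f (s t) - (1 / (n : ℝ)) * ∑ u, f (s u)) ^ 2)) ∂(Measure.pi fun _ : Fin n => μ)
      ≤ Real.exp (-l * (∫ z, (f z - ∫ w, f w ∂μ) ^ 2 ∂μ)
          + l ^ 2 * b ^ 2 * (∫ z, (f z - ∫ w, f w ∂μ) ^ 2 ∂μ) / (4 * m)) := by
  obtain ⟨z0⟩ : Nonempty Z := nonempty_of_isProbabilityMeasure μ
  have hb0 : 0 ≤ b := (abs_nonneg _).trans (hb z0 z0)
  have hB : ∀ z, |f z| ≤ b + |f z0| := fun z => by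
    have h1 := hb z z0
    have h2 := abs_sub_abs_le_abs_sub (f z) (f z0)
    linarith
  have hm0 : (0 : ℝ) < m := by exact_mod_cast hm
  set v := ∫ z, (f z - ∫ w, f w ∂μ) ^ 2 ∂μ with hv
  set θ := l / m with hθ
  have hθ0 : 0 ≤ θ := by positivity
  set g : Z × Z → ℝ := fun q => (f q.1 - f q.2) ^ 2 / 2 with hg
  have hgm : Measurable g := by fun_prop
  have hg0 : ∀ q, 0 ≤ g q := fun q => by positivity
  have hgb : ∀ q, g q ≤ b ^ 2 / 2 := fun q => by
    have := hb q.1 q.2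
    simp only [hg]
    rw [← sq_abs]
    gcongr
  have hgB : ∀ q, |g q| ≤ b ^ 2 / 2 := fun q => by rw [abs_of_nonneg (hg0 q)]; exact hgb q
  have hgi : Integrable g (μ.prod μ) := integrable_of_abs_le hgm hgB
  have hgv : ∫ q, g q ∂(μ.prod μ) = v := integral_prod_half_sq_sub μ hf hB
  have hone : ∫ q, Real.exp (-θ * g q) ∂(μ.prod μ)
      ≤ Real.exp (-θ * v + θ ^ 2 * b ^ 2 * v / 4) := by
    have h1 : ∫ q, Real.exp (-θ * g q) ∂(μ.prod μ)
        ≤ ∫ q, (1 + (-θ + θ ^ 2 * b ^ 2 / 4) * g q) ∂(μ.prod μ) := by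
      refine integral_mono
        (integrable_exp_of_abs_le (B := θ * (b ^ 2 / 2)) (by fun_prop) fun q => ?_)
        ((integrable_const _).add (hgi.const_mul _)) fun q => ?_
      · rw [abs_mul, abs_neg, abs_of_nonneg hθ0]; gcongr; exact hgB q
      · have h2 := exp_le_one_add_add_sq_half_of_nonpos
          (x := -θ * g q) (by nlinarith [mul_nonneg hθ0 (hg0 q)])
        -- Self-bounding: since `0 ≤ g ≤ b ^ 2 / 2`, the second-order term is again linear in `g`,
        -- hence proportional to `v` after integration.
        have h3 : θ ^ 2 * (g q * g q) ≤ θ ^ 2 * (b ^ 2 / 2 * g q) := by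
          refine mul_le_mul_of_nonneg_left ?_ (sq_nonneg θ)
          exact mul_le_mul_of_nonneg_right (hgb q) (hg0 q)
        simp only
        nlinarith
    refine h1.trans ?_
    rw [integral_add (integrable_const _) (hgi.const_mul _), integral_const_mul, hgv]
    refine (le_of_eq ?_).trans (Real.add_one_le_exp _)
    simp
    ring
  have hperm : ∀ σ : Equiv.Perm (Fin n),
      ∫ s, Real.exp (∑ k : Fin m, -θ * g (s (σ (pairPosition h (Sum.inl k))),
        s (σ (pairPosition h (Sum.inr k))))) ∂(Measure.pi fun _ : Fin n => μ)
      ≤ Real.exp (-l * v + l ^ 2 * b ^ 2 * v / (4 * m)) := by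
    intro σ
    have hmp := measurePreserving_pairs μ (σ.injective.comp (pairPosition_injective h))
    have h1 := integral_map (μ := Measure.pi fun _ : Fin n => μ) hmp.measurable.aemeasurable
      (f := fun q : Fin m → Z × Z => Real.exp (∑ k, -θ * g (q k)))
      (by
        refine Measurable.aestronglyMeasurable (Real.measurable_exp.comp ?_)
        exact Finset.measurable_sum _ fun t _ => (hgm.comp (measurable_pi_apply t)).const_mul _)
    rw [hmp.map_eq, integral_exp_sum_pi (μ.prod μ) m (fun q => -θ * g q)] at h1
    simp only [Function.comp] at h1
    rw [← h1]
    refine (pow_le_pow_left₀ (integral_nonneg fun _ => (Real.exp_pos _).le) hone m).trans ?_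
    rw [← Real.exp_nat_mul]
    refine Real.exp_le_exp.2 (le_of_eq ?_)
    rw [hθ]
    field_simp
  set N : ℝ := (Fintype.card (Equiv.Perm (Fin n)) : ℝ) with hN
  have hN0 : 0 < N := by rw [hN]; exact_mod_cast Fintype.card_pos
  have hsum1 : ∑ _σ : Equiv.Perm (Fin n), (1 / N) = 1 := by
    rw [Finset.sum_const, Finset.card_univ, nsmul_eq_mul, ← hN]; field_simp
  have hjensen : ∀ s : Fin n → Z, Real.exp (-l * ((1 / ((n : ℝ) - 1)) *
        ∑ t, (f (s t) - (1 / (n : ℝ)) * ∑ u, f (s u)) ^ 2))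
      ≤ ∑ σ : Equiv.Perm (Fin n), (1 / N) *
          Real.exp (∑ k : Fin m, -θ * g (s (σ (pairPosition h (Sum.inl k))),
            s (σ (pairPosition h (Sum.inr k))))) := by
    intro s
    have h1 := convexOn_exp.map_sum_le (t := Finset.univ) (w := fun _ => 1 / N)
      (p := fun σ : Equiv.Perm (Fin n) => ∑ k : Fin m,
        -θ * g (s (σ (pairPosition h (Sum.inl k))), s (σ (pairPosition h (Sum.inr k)))))
      (fun _ _ => by positivity) hsum1 (fun _ _ => Set.mem_univ _)
    simp only [smul_eq_mul] at h1
    refine (le_of_eq ?_).trans h1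
    congr 1
    rw [sampleVariance_eq_sum_perm hm h fun t => f (s t), Finset.mul_sum]
    refine Finset.sum_congr rfl fun σ _ => ?_
    rw [← Finset.mul_sum, hθ]
    simp only [hg]
    ring
  have hint : ∀ σ : Equiv.Perm (Fin n), Integrable (fun s : Fin n → Z =>
      (1 / N) * Real.exp (∑ k : Fin m, -θ * g (s (σ (pairPosition h (Sum.inl k))),
        s (σ (pairPosition h (Sum.inr k)))))) (Measure.pi fun _ : Fin n => μ) := fun σ => by
    refine (integrable_exp_of_abs_le (B := ∑ _k : Fin m, θ * (b ^ 2 / 2))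
      (Finset.measurable_sum _ fun k _ => (hgm.comp
        ((measurable_pi_apply _).prodMk (measurable_pi_apply _))).const_mul _)
      fun s => (Finset.abs_sum_le_sum_abs _ _).trans (Finset.sum_le_sum fun k _ => ?_)).const_mul _
    rw [abs_mul, abs_neg, abs_of_nonneg hθ0]; gcongr; exact hgB _
  refine (integral_mono_of_nonneg (Filter.Eventually.of_forall fun _ => (Real.exp_pos _).le)
    (integrable_finsetSum _ fun σ _ => hint σ) (Filter.Eventually.of_forall hjensen)).trans ?_
  rw [integral_finsetSum _ fun σ _ => hint σ]
  refine (Finset.sum_le_sum fun σ _ => (integral_const_mul (1 / N) _).trans_le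
    (mul_le_mul_of_nonneg_left (hperm σ) (by positivity))).trans ?_
  rw [← Finset.sum_mul, hsum1, one_mul]

/-- The standard deviation exceeds the sample standard deviation by more than
`b √(2 L / (n - 1))` with probability at most `exp (-L)`. -/
theorem sqrt_sampleVariance_lower_tail (μ : Measure Z) [IsProbabilityMeasure μ] {f : Z → ℝ}
    (hf : Measurable f) {b : ℝ} (hb : ∀ z w, |f z - f w| ≤ b) {n : ℕ} (hn : 2 ≤ n)
    {L : ℝ} (hL : 0 ≤ L) :
    (Measure.pi fun _ : Fin n => μ)
      {s | √((1 / ((n : ℝ) - 1)) * ∑ t, (f (s t) - (1 / (n : ℝ)) * ∑ u, f (s u)) ^ 2)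
          + b * √(2 * L / (n - 1)) < √(∫ z, (f z - ∫ w, f w ∂μ) ^ 2 ∂μ)}
      ≤ ENNReal.ofReal (Real.exp (-L)) := by
  obtain ⟨z0⟩ : Nonempty Z := nonempty_of_isProbabilityMeasure μ
  have hb0 : 0 ≤ b := (abs_nonneg _).trans (hb z0 z0)
  have hB : ∀ z, |f z| ≤ b + |f z0| := fun z => by
    have h1 := hb z z0
    have h2 := abs_sub_abs_le_abs_sub (f z) (f z0)
    linarith
  have hn1 : (0 : ℝ) < n - 1 := by
    have : (2 : ℝ) ≤ n := by exact_mod_cast hn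
    linarith
  -- For odd `n` one sample stays unpaired; this is where `n - 1` enters the deviation.
  obtain ⟨m, hm, h2m, hm2⟩ : ∃ m, 1 ≤ m ∧ 2 * m ≤ n ∧ n - 1 ≤ 2 * m :=
    ⟨n / 2, by omega, by omega, by omega⟩
  have hm0 : (0 : ℝ) < m := by exact_mod_cast hm
  have hm2' : (n : ℝ) - 1 ≤ 2 * m := by
    have : (n : ℝ) ≤ 2 * m + 1 := by exact_mod_cast (by omega : n ≤ 2 * m + 1)
    linarith
  set v := ∫ z, (f z - ∫ w, f w ∂μ) ^ 2 ∂μ with hv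
  set S : (Fin n → Z) → ℝ := fun s =>
    (1 / ((n : ℝ) - 1)) * ∑ t, (f (s t) - (1 / (n : ℝ)) * ∑ u, f (s u)) ^ 2 with hS
  have hS0 : ∀ s, 0 ≤ S s := fun s => by
    have := hn1.le
    simp only [hS]
    exact mul_nonneg (by positivity) (Finset.sum_nonneg fun _ _ => sq_nonneg _)
  have hv0 : 0 ≤ v := integral_nonneg fun z => sq_nonneg _
  rcases hv0.eq_or_lt with hv0 | hv0
  · refine le_of_eq_of_le ?_ zero_le
    rw [← hv0]
    rw [measure_eq_zero_iff_ae_notMem]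
    refine Filter.Eventually.of_forall fun s => ?_
    simp only [Real.sqrt_zero, Set.mem_ofPred_eq, not_lt]
    positivity
  have hvb : v ≤ b ^ 2 / 2 := by
    rw [hv, ← integral_prod_half_sq_sub μ hf hB]
    have : ∫ q : Z × Z, b ^ 2 / 2 ∂(μ.prod μ) = b ^ 2 / 2 := by simp
    rw [← this]
    refine integral_mono_of_nonneg (Filter.Eventually.of_forall fun q => by positivity)
      (integrable_const _) (Filter.Eventually.of_forall fun q => ?_)
    have := hb q.1 q.2
    simp only
    rw [← sq_abs (f q.1 - f q.2)]
    gcongr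
  have hb1 : 0 < b := by
    refine hb0.lt_of_ne fun h => ?_
    rw [← h] at hvb
    norm_num at hvb
    linarith
  -- Chosen so that the quadratic term `l ^ 2 b ^ 2 v / (4 m)` of the exponent equals `L`. The
  -- required gain `l u √v`, with `u = b √(L / m)`, is then exactly `2 L`.
  set l := 2 * √(m * L) / (b * √v) with hl
  have hl0 : 0 ≤ l := by positivity
  have hsv : √v ^ 2 = v := Real.sq_sqrt hv0.le
  have hsv0 : 0 < √v := Real.sqrt_pos.2 hv0
  have hmL : √(m * L) ^ 2 = m * L := Real.sq_sqrt (by positivity)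
  have hmgf := integral_exp_neg_sampleVariance_le μ hf hb hm h2m hl0
  have hB2 : -l * v + l ^ 2 * b ^ 2 * v / (4 * m) = -l * v + L := by
    rw [hl, div_pow, mul_pow, mul_pow, hmL, hsv]
    field_simp
    ring
  rw [← hv, hB2] at hmgf
  have hSm : Measurable S := by
    have : ∀ t : Fin n, Measurable fun s : Fin n → Z => f (s t) := fun t =>
      hf.comp (measurable_pi_apply t)
    fun_prop
  have hint : Integrable (fun s => Real.exp (-l * S s)) (Measure.pi fun _ : Fin n => μ) := by
    refine integrable_of_abs_le (B := 1) (by fun_prop) fun s => ?_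
    rw [Real.abs_exp, Real.exp_le_one_iff]
    nlinarith [mul_nonneg hl0 (hS0 s)]
  refine (measure_mono fun s hs => ?_).trans (measure_add_le_le_of_integral_exp_le hint hmgf)
  simp only [Set.mem_ofPred_eq] at hs ⊢
  have h1 : √(L / m) ≤ √(2 * L / (n - 1)) := by
    refine Real.sqrt_le_sqrt ?_
    rw [div_le_div_iff₀ hm0 hn1]
    nlinarith
  set u := b * √(L / m) with hu
  have hu0 : 0 ≤ u := by positivity
  have h2 : √(S s) < √v - u := by
    have : u ≤ b * √(2 * L / (n - 1)) := by rw [hu]; gcongr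
    linarith
  have h3 : S s ≤ (√v - u) ^ 2 := by
    rw [← Real.sq_sqrt (hS0 s)]
    gcongr
  -- Expanding the square leaves `v - 2 u √v + u ^ 2`, and `u ≤ √v` because `√(S s)` is nonnegative.
  have h4 : S s ≤ v - u * √v := by
    have h5 : 0 ≤ √(S s) := Real.sqrt_nonneg _
    nlinarith
  have h5 : l * (u * √v) = 2 * L := by
    have h6 : √(m * L) * √(L / m) = L := by
      rw [← Real.sqrt_mul (by positivity), show m * L * (L / m) = L ^ 2 by field_simp,
        Real.sqrt_sq hL]
    rw [hl, hu]
    field_simp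
    linear_combination h6
  nlinarith [mul_le_mul_of_nonneg_left h4 hl0]

end EmpiricalVariance

/-! ### Two-sided Hoeffding and empirical Bernstein inequalities -/

section TwoSided

variable {Z : Type*} [MeasurableSpace Z]

/-- Two-sided **Hoeffding inequality** for the sample mean of a bounded function. -/
theorem hoeffding_abs_sampleMean (μ : Measure Z) [IsProbabilityMeasure μ] {f : Z → ℝ}
    (hf : Measurable f) {a b : ℝ} (hab : ∀ z, f z ∈ Set.Icc a b) {n : ℕ} (hn : 1 ≤ n) {L : ℝ}
    (hL : 0 ≤ L) :
    (Measure.pi fun _ : Fin n => μ)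
      {s | (b - a) * √(L / (2 * n)) < |∫ z, f z ∂μ - (1 / (n : ℝ)) * ∑ t, f (s t)|}
      ≤ ENNReal.ofReal (2 * Real.exp (-L)) := by
  have h1 := hoeffding_sampleMean μ hf hab hn hL
  have h2 := hoeffding_sampleMean μ (f := fun z => -f z) hf.neg (a := -b) (b := -a)
    (fun z => ⟨neg_le_neg (hab z).2, neg_le_neg (hab z).1⟩) hn hL
  rw [two_mul (Real.exp (-L)), ENNReal.ofReal_add (Real.exp_pos _).le (Real.exp_pos _).le]
  refine (measure_mono ?_).trans ((measure_union_le _ _).trans (add_le_add h1 h2))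
  intro s hs
  simp only [Set.mem_ofPred_eq, Set.mem_union, integral_neg, Finset.sum_neg_distrib] at hs ⊢
  rcases lt_abs.1 hs with h | h
  · right
    linarith
  · left
    linarith

/-- **Empirical Bernstein inequality** for the sample mean of a bounded function. -/
theorem empirical_bernstein_abs_sampleMean (μ : Measure Z) [IsProbabilityMeasure μ] {f : Z → ℝ}
    (hf : Measurable f) {C : ℝ} (hC : ∀ z, |f z| ≤ C) {n : ℕ} (hn : 2 ≤ n) {L : ℝ}
    (hL : 0 ≤ L) :
    (Measure.pi fun _ : Fin n => μ)
      {s | √(2 * ((1 / ((n : ℝ) - 1)) * ∑ t, (f (s t) - (1 / (n : ℝ)) * ∑ u, f (s u)) ^ 2) * L / n)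
          + 14 * C * L / (3 * ((n : ℝ) - 1)) < |∫ z, f z ∂μ - (1 / (n : ℝ)) * ∑ t, f (s t)|}
      ≤ ENNReal.ofReal (3 * Real.exp (-L)) := by
  obtain ⟨z0⟩ : Nonempty Z := nonempty_of_isProbabilityMeasure μ
  have hC0 : 0 ≤ C := (abs_nonneg _).trans (hC z0)
  have hn1 : (0 : ℝ) < n - 1 := by
    have : (2 : ℝ) ≤ n := by exact_mod_cast hn
    linarith
  have hn0 : (0 : ℝ) < n := by linarith
  have hm : |∫ z, f z ∂μ| ≤ C := by
    have := norm_integral_le_of_norm_le_const (μ := μ) (f := f) (C := C)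
      (Filter.Eventually.of_forall hC)
    simpa using this
  have hfb : ∀ z, |f z - ∫ w, f w ∂μ| ≤ 2 * C := fun z =>
    (abs_sub _ _).trans (by linarith [hC z])
  have h1 := bernstein_sampleMean μ hf hfb (by omega : 1 ≤ n) hL
  have h2 := bernstein_sampleMean μ (f := fun z => -f z) hf.neg (b := 2 * C)
    (fun z => by rw [integral_neg, ← neg_sub', abs_neg]; exact hfb z) (by omega : 1 ≤ n) hL
  have h3 := sqrt_sampleVariance_lower_tail μ hf (b := 2 * C)
    (fun z w => (abs_sub _ _).trans (by linarith [hC z, hC w])) hn hL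
  have he : 0 ≤ Real.exp (-L) := (Real.exp_pos _).le
  rw [show 3 * Real.exp (-L) = Real.exp (-L) + Real.exp (-L) + Real.exp (-L) by ring,
    ENNReal.ofReal_add (by positivity) he, ENNReal.ofReal_add he he]
  refine (measure_mono ?_).trans ((measure_union_le _ _).trans (add_le_add
    ((measure_union_le _ _).trans (add_le_add h1 h2)) h3))
  intro s hs
  by_contra hnot
  simp only [Set.mem_ofPred_eq, Set.mem_union, integral_neg, Finset.sum_neg_distrib, not_or,
    not_lt] at hs hnot
  obtain ⟨⟨g1, g2⟩, g3⟩ := hnot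
  rw [show ∫ z, (-f z - -∫ w, f w ∂μ) ^ 2 ∂μ = ∫ z, (f z - ∫ w, f w ∂μ) ^ 2 ∂μ from
    integral_congr_ae (Filter.Eventually.of_forall fun z => by simp only; ring)] at g2
  set v := ∫ z, (f z - ∫ w, f w ∂μ) ^ 2 ∂μ with hv
  have hv0 : 0 ≤ v := integral_nonneg fun z => sq_nonneg _
  set S := (1 / ((n : ℝ) - 1)) * ∑ t, (f (s t) - (1 / (n : ℝ)) * ∑ u, f (s u)) ^ 2 with hS
  have hS0 : 0 ≤ S :=
    mul_nonneg (by have := hn1.le; positivity) (Finset.sum_nonneg fun _ _ => sq_nonneg _)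
  have e1 : √(2 * v * L / n) = √v * √(2 * L / n) := by
    rw [← Real.sqrt_mul hv0]; congr 1; ring
  have e2 : √(2 * S * L / n) = √S * √(2 * L / n) := by
    rw [← Real.sqrt_mul hS0]; congr 1; ring
  have e3 : √(2 * L / (n - 1)) * √(2 * L / n) ≤ 2 * L / (n - 1) := by
    calc √(2 * L / (n - 1)) * √(2 * L / n) ≤ √(2 * L / (n - 1)) * √(2 * L / (n - 1)) := by
          gcongr; linarith
      _ = 2 * L / (n - 1) := Real.mul_self_sqrt (by positivity)
  have e4 : √v * √(2 * L / n) ≤ √S * √(2 * L / n) + 2 * C * (2 * L / (n - 1)) := by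
    have := mul_le_mul_of_nonneg_right g3 (Real.sqrt_nonneg (2 * L / n))
    have := mul_le_mul_of_nonneg_left e3 (show 0 ≤ 2 * C by positivity)
    linarith
  have e5 : 2 * C * L / (3 * n) ≤ 2 * C * L / (3 * (n - 1)) := by
    gcongr; linarith
  -- `14 / 3 = 4 + 2 / 3`: the `4` is the price of replacing `√v` by `√S`, and the `2 / 3` is
  -- Bernstein's linear term with range `2 C`.
  have e6 : 14 * C * L / (3 * ((n : ℝ) - 1))
      = 2 * C * (2 * L / (n - 1)) + 2 * C * L / (3 * (n - 1)) := by
    field_simp; ring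
  rw [e1] at g1 g2
  rw [e2, e6] at hs
  rcases lt_abs.1 hs with h | h <;> linarith

end TwoSided

/-! ### McDiarmid's inequality -/

section BoundedDifferences

variable {Z : Type*} [MeasurableSpace Z]

/-- **McDiarmid's inequality**, in the form of a moment generating function bound: a function of
`k` independent samples that changes by at most `c` when one sample is changed is sub-Gaussian. -/
theorem hasSubgaussianMGF_of_bounded_differences (ν : Measure Z) [IsProbabilityMeasure ν]
    {c B : ℝ} {k : ℕ} {f : (Fin k → Z) → ℝ} (hf : Measurable f) (hB : ∀ x, |f x| ≤ B)
    (hd : ∀ x i z, |f (Function.update x i z) - f x| ≤ c) :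
    HasSubgaussianMGF (fun x => f x - ∫ y, f y ∂(Measure.pi fun _ : Fin k => ν))
      (k * (‖c‖₊ / 2) ^ 2) (Measure.pi fun _ : Fin k => ν) := by
  induction k with
  | zero =>
    have h1 : ∀ x, f x - ∫ y, f y ∂(Measure.pi fun _ : Fin 0 => ν) = 0 := by
      intro x
      have : ∀ y, f y = f x := fun y => congrArg f (Subsingleton.elim _ _)
      simp [this]
    simp_rw [h1]
    simp
  | succ k ih =>
    obtain ⟨z0⟩ : Nonempty Z := nonempty_of_isProbabilityMeasure ν
    set P := Measure.pi fun _ : Fin k => ν with hP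
    have hmp : MeasurePreserving (fun q : Z × (Fin k → Z) => (Fin.cons q.1 q.2 : Fin (k + 1) → Z))
        (ν.prod P) (Measure.pi fun _ : Fin (k + 1) => ν) := by
      have := (measurePreserving_piFinSuccAbove (fun _ : Fin (k + 1) => ν) 0).symm
      convert this using 1
      funext q
      exact (Fin.insertNth_zero' q.1 q.2).symm
    have hcons : Measurable fun q : Z × (Fin k → Z) => (Fin.cons q.1 q.2 : Fin (k + 1) → Z) :=
      hmp.measurable
    set F : Z × (Fin k → Z) → ℝ := fun q => f (Fin.cons q.1 q.2) with hF
    have hFm : Measurable F := hf.comp hcons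
    have hFi : Integrable F (ν.prod P) := integrable_of_abs_le hFm fun q => hB _
    -- Averaging out the first sample keeps bounded differences, so the induction hypothesis
    -- controls `g - m`. The increment `F - g` is treated conditionally on the other samples.
    set g : (Fin k → Z) → ℝ := fun x => ∫ z, F (z, x) ∂ν with hg
    have hgm : Measurable g := by
      have := (hFm.comp measurable_swap).stronglyMeasurable.integral_prod_right' (ν := ν)
      exact this.measurable
    have hFx : ∀ x, Measurable fun z => F (z, x) := fun x => hFm.comp measurable_prodMk_right
    have hFxi : ∀ x, Integrable (fun z => F (z, x)) ν := fun x =>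
      integrable_of_abs_le (hFx x) fun q => hB _
    have hgB : ∀ x, |g x| ≤ B := fun x => by
      have := norm_integral_le_of_norm_le_const (μ := ν) (f := fun z => F (z, x)) (C := B)
        (Filter.Eventually.of_forall fun z => hB _)
      simpa using this
    have hgd : ∀ x i z, |g (Function.update x i z) - g x| ≤ c := by
      intro x i z
      have h1 : g (Function.update x i z) - g x
          = ∫ w, (F (w, Function.update x i z) - F (w, x)) ∂ν :=
        (integral_sub (hFxi _) (hFxi _)).symm
      rw [h1]
      have := norm_integral_le_of_norm_le_const (μ := ν)
        (f := fun w => F (w, Function.update x i z) - F (w, x)) (C := c)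
        (Filter.Eventually.of_forall fun w => by
          simp only [hF, Fin.cons_update]
          exact hd _ _ _)
      simpa using this
    have hEf : ∫ y, f y ∂(Measure.pi fun _ : Fin (k + 1) => ν) = ∫ x, g x ∂P := by
      rw [← hmp.map_eq, integral_map hcons.aemeasurable hf.aestronglyMeasurable]
      exact integral_prod_symm F hFi
    have hmgf := ih hgm hgB hgd
    rw [hEf]
    set m := ∫ x, g x ∂P with hm
    have hc0 : 0 ≤ c := (abs_nonneg _).trans (hd (fun _ => z0) 0 z0)
    have hinner : ∀ x, HasSubgaussianMGF (fun z => F (z, x) - g x) ((‖c‖₊ / 2) ^ 2) ν := by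
      intro x
      have hbdd : BddBelow (Set.range fun z => F (z, x)) :=
        ⟨-B, by rintro _ ⟨z, rfl⟩; exact (abs_le.1 (hB _)).1⟩
      have : Nonempty Z := ⟨z0⟩
      -- Starting the interval at the infimum gives it length `c`; centring at a value of `F` would
      -- give `2 c`.
      have h1 := hasSubgaussianMGF_of_mem_Icc (μ := ν) (X := fun z => F (z, x))
        (a := ⨅ z, F (z, x)) (b := (⨅ z, F (z, x)) + c) (hFx x).aemeasurable
        (Filter.Eventually.of_forall fun z => ⟨ciInf_le hbdd z, by
          rw [← sub_le_iff_le_add]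
          refine le_ciInf fun z' => ?_
          have h2 := hd (Fin.cons z x) 0 z'
          rw [Fin.update_cons_zero] at h2
          have := (abs_le.1 h2).1
          simp only [hF]
          linarith⟩)
      rwa [add_sub_cancel_left] at h1
    have hint : ∀ t, Integrable (fun x => Real.exp (t * (f x - m)))
        (Measure.pi fun _ : Fin (k + 1) => ν) := fun t =>
      integrable_exp_of_abs_le (B := |t| * (B + |m|)) (by fun_prop) fun x => by
        rw [abs_mul]; gcongr; exact (abs_sub _ _).trans (by gcongr; exact hB x)
    refine ⟨hint, fun t => ?_⟩
    have hint2 : Integrable (fun q : Z × (Fin k → Z) => Real.exp (t * (F q - m))) (ν.prod P) :=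
      integrable_exp_of_abs_le (B := |t| * (B + |m|)) (by fun_prop) fun x => by
        rw [abs_mul]; gcongr; exact (abs_sub _ _).trans (by gcongr; exact hB _)
    have h1 : mgf (fun x => f x - m) (Measure.pi fun _ : Fin (k + 1) => ν) t
        = ∫ x, ∫ z, Real.exp (t * (F (z, x) - m)) ∂ν ∂P := by
      rw [mgf, ← hmp.map_eq, integral_map hcons.aemeasurable (by fun_prop)]
      exact integral_prod_symm (fun q => Real.exp (t * (F q - m))) hint2
    have h2 : ∀ x, ∫ z, Real.exp (t * (F (z, x) - m)) ∂ν
        ≤ Real.exp (((‖c‖₊ / 2) ^ 2 : NNReal) * t ^ 2 / 2) * Real.exp (t * (g x - m)) := by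
      intro x
      have h3 := (hinner x).mgf_le t
      rw [mgf] at h3
      have h4 : ∀ z, Real.exp (t * (F (z, x) - m))
          = Real.exp (t * (F (z, x) - g x)) * Real.exp (t * (g x - m)) := fun z => by
        rw [← Real.exp_add]; ring_nf
      simp_rw [h4]
      rw [integral_mul_const]
      gcongr
    rw [h1]
    calc ∫ x, ∫ z, Real.exp (t * (F (z, x) - m)) ∂ν ∂P
        ≤ ∫ x, Real.exp (((‖c‖₊ / 2) ^ 2 : NNReal) * t ^ 2 / 2) * Real.exp (t * (g x - m)) ∂P :=
          integral_mono_of_nonneg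
            (Filter.Eventually.of_forall fun x => integral_nonneg fun _ => (Real.exp_pos _).le)
            ((hmgf.integrable_exp_mul t).const_mul _) (Filter.Eventually.of_forall h2)
      _ ≤ Real.exp (((‖c‖₊ / 2) ^ 2 : NNReal) * t ^ 2 / 2)
          * Real.exp ((k * (‖c‖₊ / 2) ^ 2 : NNReal) * t ^ 2 / 2) := by
          rw [integral_const_mul]
          gcongr
          exact hmgf.mgf_le t
      _ = Real.exp (((k + 1 : ℕ) * (‖c‖₊ / 2) ^ 2 : NNReal) * t ^ 2 / 2) := by
          rw [← Real.exp_add]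
          push_cast
          ring_nf

end BoundedDifferences

/-! ### Bounds for suprema over an index set -/

section Suprema

variable {ι : Type*} {g h : ι → ℝ} {B c : ℝ}

theorem bddAbove_range_of_abs_le (hg : ∀ i, |g i| ≤ B) : BddAbove (Set.range g) :=
  ⟨B, by rintro _ ⟨i, rfl⟩; exact (abs_le.1 (hg i)).2⟩

theorem abs_ciSup_le [Nonempty ι] (hg : ∀ i, |g i| ≤ B) : |⨆ i, g i| ≤ B := by
  obtain ⟨i⟩ := ‹Nonempty ι›
  have : Nonempty ι := ⟨i⟩
  exact abs_le.2 ⟨(abs_le.1 (hg i)).1.trans (le_ciSup (bddAbove_range_of_abs_le hg) i),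
    ciSup_le fun j => (abs_le.1 (hg j)).2⟩

theorem abs_ciSup_sub_ciSup_le [Nonempty ι] (hg : BddAbove (Set.range g)) (hh : BddAbove (Set.range h))
    (hgh : ∀ i, |g i - h i| ≤ c) : |(⨆ i, g i) - ⨆ i, h i| ≤ c := by
  rw [abs_le, neg_le_sub_iff_le_add, sub_le_iff_le_add]
  constructor
  · refine ciSup_le fun i => ?_
    have h1 := (abs_le.1 (hgh i)).1
    have h2 := le_ciSup hg i
    linarith
  · refine ciSup_le fun i => ?_
    have h1 := (abs_le.1 (hgh i)).2
    have h2 := le_ciSup hh i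
    linarith

end Suprema

/-! ### Suprema of signed averages -/

section SignedSuprema

variable {X : Type*}

/-- The supremum over `F` of the signed averages `(1/k) ∑ ε_i ψ(x_i)`. -/
noncomputable def signedSup (F : Set (X → ℝ)) {k : ℕ} (ε : Fin k → ℤˣ) (x : Fin k → X) : ℝ :=
  ⨆ ψ : F, (1 / (k : ℝ)) * ∑ i, ((ε i : ℤ) : ℝ) * (ψ : X → ℝ) (x i)

/-- The supremum over `F` of the signed averages of the differences over pairs of points. -/
noncomputable def signedPairSup (F : Set (X → ℝ)) {k : ℕ} (ε : Fin k → ℤˣ)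
    (q : Fin k → X × X) : ℝ :=
  ⨆ ψ : F, (1 / (k : ℝ)) * ∑ i, ((ε i : ℤ) : ℝ) * ((ψ : X → ℝ) (q i).1 - (ψ : X → ℝ) (q i).2)

theorem abs_intUnit_mul (e : ℤˣ) (x : ℝ) : |((e : ℤ) : ℝ) * x| = |x| := by
  rcases Int.units_eq_one_or e with rfl | rfl <;> simp

theorem abs_average_signed_le {k : ℕ} (hk : 1 ≤ k) (ε : Fin k → ℤˣ) {y : Fin k → ℝ} {B : ℝ}
    (hy : ∀ i, |y i| ≤ B) : |(1 / (k : ℝ)) * ∑ i, ((ε i : ℤ) : ℝ) * y i| ≤ B := by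
  have hk0 : (0 : ℝ) < k := by exact_mod_cast hk
  rw [abs_mul, abs_of_pos (by positivity)]
  have h1 : |∑ i, ((ε i : ℤ) : ℝ) * y i| ≤ ∑ _i : Fin k, B :=
    (Finset.abs_sum_le_sum_abs _ _).trans
      (Finset.sum_le_sum fun i _ => (abs_intUnit_mul _ _).trans_le (hy i))
  rw [Finset.sum_const, Finset.card_univ, Fintype.card_fin, nsmul_eq_mul] at h1
  calc 1 / (k : ℝ) * |∑ i, ((ε i : ℤ) : ℝ) * y i| ≤ 1 / (k : ℝ) * (k * B) := by gcongr
    _ = B := by field_simp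

variable {F : Set (X → ℝ)} {C : ℝ} {k : ℕ}

theorem abs_signedSup_le [Nonempty F] (hC : ∀ ψ ∈ F, ∀ x, |ψ x| ≤ C) (hk : 1 ≤ k) (ε : Fin k → ℤˣ)
    (x : Fin k → X) : |signedSup F ε x| ≤ C :=
  abs_ciSup_le fun ψ => abs_average_signed_le hk ε fun _ => hC ψ ψ.2 _

theorem abs_signedPairSup_le [Nonempty F] (hC : ∀ ψ ∈ F, ∀ x, |ψ x| ≤ C) (hk : 1 ≤ k) (ε : Fin k → ℤˣ)
    (q : Fin k → X × X) : |signedPairSup F ε q| ≤ 2 * C :=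
  abs_ciSup_le fun ψ => abs_average_signed_le hk ε fun _ =>
    (abs_sub _ _).trans (by linarith [hC ψ ψ.2 (q ‹_›).1, hC ψ ψ.2 (q ‹_›).2])

end SignedSuprema

/-! ### Symmetrization and uniform deviation over the family -/

section Symmetrization

variable {X : Type*} [MeasurableSpace X]

theorem measurePreserving_fst_pi (ν : Measure X) [IsProbabilityMeasure ν] (k : ℕ) :
    MeasurePreserving (fun (q : Fin k → X × X) i => (q i).1)
      (Measure.pi fun _ : Fin k => ν.prod ν) (Measure.pi fun _ : Fin k => ν) :=
  measurePreserving_fst.comp (measurePreserving_arrowProdEquivProdArrow X X (Fin k) (fun _ => ν)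
    (fun _ => ν))

theorem measurePreserving_snd_pi (ν : Measure X) [IsProbabilityMeasure ν] (k : ℕ) :
    MeasurePreserving (fun (q : Fin k → X × X) i => (q i).2)
      (Measure.pi fun _ : Fin k => ν.prod ν) (Measure.pi fun _ : Fin k => ν) :=
  measurePreserving_snd.comp (measurePreserving_arrowProdEquivProdArrow X X (Fin k) (fun _ => ν)
    (fun _ => ν))

/-- The supremum over `F` of the signed deviations between expectation and sample average. -/
noncomputable def deviationSup (ν : Measure X) (F : Set (X → ℝ)) {k : ℕ} (r : ℤˣ)
    (x : Fin k → X) : ℝ :=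
  ⨆ ψ : F, (((r : ℤ) : ℝ) * (∫ u, (ψ : X → ℝ) u ∂ν)
    + ∑ i, (-((r : ℤ) : ℝ) / k) * (ψ : X → ℝ) (x i))

variable {ν : Measure X} {F : Set (X → ℝ)} {C : ℝ} {k : ℕ}

theorem measurable_signedSup (hF : HasMeasurableSuprema ν F) (ε : Fin k → ℤˣ) :
    Measurable (signedSup F ε) := by
  have := hF k (fun i => (1 / (k : ℝ)) * ((ε i : ℤ) : ℝ)) 0
  convert this using 3 with x
  unfold signedSup
  congr 1
  ext ψ
  simp [Finset.mul_sum, mul_assoc]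

/-- The `k` pairs are read as `2 k` points with opposite coefficients, which the measurability
convention allows. -/
theorem measurable_signedPairSup (hF : HasMeasurableSuprema ν F) (ε : Fin k → ℤˣ) :
    Measurable (signedPairSup F ε) := by
  have h1 := hF (k + k) (Fin.append (fun i => (1 / (k : ℝ)) * ((ε i : ℤ) : ℝ))
    (fun i => -((1 / (k : ℝ)) * ((ε i : ℤ) : ℝ)))) 0
  have h2 : Measurable fun q : Fin k → X × X =>
      (Fin.append (fun i => (q i).1) (fun i => (q i).2) : Fin (k + k) → X) := by
    refine measurable_pi_iff.2 fun j => ?_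
    refine Fin.addCases (fun i => ?_) (fun i => ?_) j
    · simp only [Fin.append_left]; fun_prop
    · simp only [Fin.append_right]; fun_prop
  convert h1.comp h2 using 1
  ext q
  unfold signedPairSup
  simp only [Function.comp]
  congr 1
  ext ψ
  simp only [Fin.sum_univ_add, Fin.append_left, Fin.append_right, zero_mul, zero_add,
    Finset.mul_sum, ← Finset.sum_add_distrib]
  exact Finset.sum_congr rfl fun i _ => by ring

/-- Exchanging the two points in some of the pairs does not change the expectation. -/
theorem integral_signedPairSup_mul [IsProbabilityMeasure ν] (hF : HasMeasurableSuprema ν F) (ε η : Fin k → ℤˣ) :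
    ∫ q, signedPairSup F (ε * η) q ∂(Measure.pi fun _ : Fin k => ν.prod ν)
      = ∫ q, signedPairSup F ε q ∂(Measure.pi fun _ : Fin k => ν.prod ν) := by
  -- Swapping pair `i` when `η i = -1` preserves `ν.prod ν` and flips the sign of the `i`-th
  -- difference.
  have hmp : MeasurePreserving
      (fun (q : Fin k → X × X) i => (if η i = 1 then id else Prod.swap) (q i))
      (Measure.pi fun _ : Fin k => ν.prod ν) (Measure.pi fun _ : Fin k => ν.prod ν) :=
    measurePreserving_pi _ _ fun i => by
      split_ifs
      · exact MeasurePreserving.id _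
      · exact Measure.measurePreserving_swap
  conv_rhs => rw [← hmp.map_eq, integral_map hmp.measurable.aemeasurable
    (measurable_signedPairSup hF ε).aestronglyMeasurable]
  congr 1
  ext q
  unfold signedPairSup
  congr 1
  ext ψ
  congr 1
  refine Finset.sum_congr rfl fun i _ => ?_
  rcases Int.units_eq_one_or (η i) with h | h
  · simp [h]
  · simp [h]; ring

theorem abs_integral_le_of_abs_le [IsProbabilityMeasure ν] {f : X → ℝ} (hC : ∀ x, |f x| ≤ C) :
    |∫ u, f u ∂ν| ≤ C := by
  simpa using norm_integral_le_of_norm_le_const (μ := ν) (f := f) (C := C)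
    (Filter.Eventually.of_forall hC)

theorem deviation_eq (r : ℤˣ) (f : X → ℝ) (x : Fin k → X) :
    ((r : ℤ) : ℝ) * (∫ u, f u ∂ν) + ∑ i, (-((r : ℤ) : ℝ) / k) * f (x i)
      = ((r : ℤ) : ℝ) * (∫ u, f u ∂ν - (1 / (k : ℝ)) * ∑ i, f (x i)) := by
  rw [← Finset.mul_sum]
  ring

theorem abs_deviation_le [IsProbabilityMeasure ν] (hk : 1 ≤ k) (r : ℤˣ) {f : X → ℝ}
    (hC : ∀ x, |f x| ≤ C) (x : Fin k → X) :
    |((r : ℤ) : ℝ) * (∫ u, f u ∂ν) + ∑ i, (-((r : ℤ) : ℝ) / k) * f (x i)| ≤ 2 * C := by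
  rw [deviation_eq, abs_intUnit_mul]
  have h1 := abs_average_signed_le hk (fun _ => 1) (y := fun i => f (x i)) fun i => hC _
  simp only [Units.val_one, Int.cast_one, one_mul] at h1
  exact (abs_sub _ _).trans (by linarith [abs_integral_le_of_abs_le (ν := ν) hC])

/-- **Symmetrization**: the expected supremum of the deviations is at most twice the Rademacher
complexity. -/
theorem integral_deviationSup_le [IsProbabilityMeasure ν] [Nonempty F]
    (hFm : ∀ ψ ∈ F, Measurable ψ) (hF : HasMeasurableSuprema ν F)
    (hC : ∀ ψ ∈ F, ∀ x, |ψ x| ≤ C) (hk : 1 ≤ k) (r : ℤˣ) :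
    ∫ x, deviationSup ν F r x ∂(Measure.pi fun _ : Fin k => ν)
      ≤ 2 * rademacherComplexity ν F k := by
  have hk0 : (0 : ℝ) < k := by exact_mod_cast hk
  set P := Measure.pi fun _ : Fin k => ν with hP
  set Q := Measure.pi fun _ : Fin k => ν.prod ν with hQ
  have hWi : ∀ ε : Fin k → ℤˣ, Integrable (signedPairSup F ε) Q := fun ε =>
    integrable_of_abs_le (measurable_signedPairSup hF ε) (abs_signedPairSup_le hC hk ε)
  have hTi : ∀ ε : Fin k → ℤˣ, Integrable (signedSup F ε) P := fun ε =>
    integrable_of_abs_le (measurable_signedSup hF ε) (abs_signedSup_le hC hk ε)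
  have hmp := (measurePreserving_arrowProdEquivProdArrow X X (Fin k) (fun _ => ν)
    (fun _ => ν)).symm
  -- Ghost sample: the mean of `ψ` is the expected average over an independent second sample, and a
  -- supremum of expectations is at most the expected supremum.
  have hghost : ∫ x, deviationSup ν F r x ∂P ≤ ∫ q, signedPairSup F (fun _ : Fin k => r) q ∂Q := by
    set G : (Fin k → X) × (Fin k → X) → ℝ := fun p =>
      signedPairSup F (fun _ => r) fun i => (p.1 i, p.2 i) with hG
    have hGm : Measurable G := (measurable_signedPairSup hF _).comp hmp.measurable
    have hGi : Integrable G (P.prod P) :=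
      integrable_of_abs_le hGm fun p => abs_signedPairSup_le hC hk _ _
    have h1 : ∫ q, signedPairSup F (fun _ : Fin k => r) q ∂Q = ∫ x, ∫ x', G (x', x) ∂P ∂P := by
      rw [← integral_prod_symm G hGi, hQ, ← hmp.map_eq,
        integral_map hmp.measurable.aemeasurable
          (measurable_signedPairSup hF _).aestronglyMeasurable]
      rfl
    rw [h1]
    refine integral_mono
      (integrable_of_abs_le (B := 2 * C) (hF k _ _) fun x => abs_ciSup_le fun ψ => ?_)
      hGi.integral_prod_right fun x => ?_
    · exact abs_deviation_le hk r (hC ψ ψ.2) x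
    · refine ciSup_le fun ψ => ?_
      have hi : ∀ i, Integrable (fun x' : Fin k → X => (ψ : X → ℝ) (x' i)) P := fun i =>
        integrable_of_abs_le ((hFm ψ ψ.2).comp (measurable_pi_apply i)) fun x' => hC ψ ψ.2 _
      have hi' : ∀ i, Integrable (fun x' : Fin k → X => ((r : ℤ) : ℝ) *
          ((ψ : X → ℝ) (x' i) - (ψ : X → ℝ) (x i))) P := fun i =>
        ((hi i).sub (integrable_const _)).const_mul _
      have he : ∀ i, ∫ x' : Fin k → X, (ψ : X → ℝ) (x' i) ∂P = ∫ u, (ψ : X → ℝ) u ∂ν := by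
        intro i
        have hm := measurePreserving_eval (fun _ : Fin k => ν) i
        conv_rhs => rw [← hm.map_eq, integral_map hm.measurable.aemeasurable
          (hFm ψ ψ.2).aestronglyMeasurable]
      have hterm : ∫ x' : Fin k → X, (1 / (k : ℝ)) * ∑ i, ((r : ℤ) : ℝ) *
          ((ψ : X → ℝ) (x' i) - (ψ : X → ℝ) (x i)) ∂P = ((r : ℤ) : ℝ) * (∫ u, (ψ : X → ℝ) u ∂ν)
            + ∑ i, (-((r : ℤ) : ℝ) / k) * (ψ : X → ℝ) (x i) := by
        rw [integral_const_mul, integral_finsetSum _ fun i _ => hi' i]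
        simp_rw [integral_const_mul]
        have h2 : ∀ i, ∫ x' : Fin k → X, ((ψ : X → ℝ) (x' i) - (ψ : X → ℝ) (x i)) ∂P
            = ∫ u, (ψ : X → ℝ) u ∂ν - (ψ : X → ℝ) (x i) := fun i => by
          rw [integral_sub (hi i) (integrable_const _), he i]
          simp
        simp_rw [h2]
        rw [deviation_eq, ← Finset.mul_sum, Finset.sum_sub_distrib]
        simp
        field_simp
      rw [← hterm]
      refine integral_mono
        ((integrable_finsetSum _ fun i _ => hi' i).const_mul _)
        (integrable_of_abs_le (B := 2 * C) (hGm.comp measurable_prodMk_right)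
          fun x' => abs_signedPairSup_le hC hk _ _) fun x' => ?_
      exact le_ciSup (bddAbove_range_of_abs_le (B := 2 * C) (g := fun ψ : F => (1 / (k : ℝ)) *
        ∑ i, ((r : ℤ) : ℝ) * ((ψ : X → ℝ) (x' i) - (ψ : X → ℝ) (x i))) fun ψ =>
          abs_average_signed_le hk (fun _ => r) fun i =>
            (abs_sub _ _).trans (by linarith [hC ψ ψ.2 (x' i), hC ψ ψ.2 (x i)])) ψ
  refine hghost.trans ?_
  have hswap : ∀ ε : Fin k → ℤˣ, ∫ q, signedPairSup F (fun _ : Fin k => r) q ∂Q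
      = ∫ q, signedPairSup F ε q ∂Q := fun ε => by
    have := integral_signedPairSup_mul hF ε ((fun _ => r) * ε⁻¹)
    rw [mul_comm (fun _ => r), mul_inv_cancel_left] at this
    exact this
  -- The supremum is subadditive. The second sample carries `-ε`, but summing over all sign vectors
  -- absorbs the negation and yields the factor `2`.
  have hsplit : ∀ ε : Fin k → ℤˣ, ∫ q, signedPairSup F ε q ∂Q
      ≤ ∫ x, signedSup F ε x ∂P + ∫ x, signedSup F (-ε) x ∂P := by
    intro ε
    have m1 := measurePreserving_fst_pi ν k
    have m2 := measurePreserving_snd_pi ν k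
    have e1 : ∫ x, signedSup F ε x ∂P = ∫ q, signedSup F ε (fun i => (q i).1) ∂Q := by
      rw [hP, ← m1.map_eq, integral_map m1.measurable.aemeasurable
        (measurable_signedSup hF _).aestronglyMeasurable]
    have e2 : ∫ x, signedSup F (-ε) x ∂P = ∫ q, signedSup F (-ε) (fun i => (q i).2) ∂Q := by
      rw [hP, ← m2.map_eq, integral_map m2.measurable.aemeasurable
        (measurable_signedSup hF _).aestronglyMeasurable]
    have i1 : Integrable (fun q : Fin k → X × X => signedSup F ε (fun i => (q i).1)) Q :=
      m1.integrable_comp_of_integrable (hTi ε)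
    have i2 : Integrable (fun q : Fin k → X × X => signedSup F (-ε) (fun i => (q i).2)) Q :=
      m2.integrable_comp_of_integrable (hTi (-ε))
    rw [e1, e2, ← integral_add i1 i2]
    refine integral_mono (hWi ε) (i1.add i2) fun q => ciSup_le fun ψ => ?_
    have b1 := le_ciSup (bddAbove_range_of_abs_le (g := fun ψ : F => (1 / (k : ℝ)) *
      ∑ i, ((ε i : ℤ) : ℝ) * (ψ : X → ℝ) (q i).1) fun ψ =>
        abs_average_signed_le hk ε fun _ => hC ψ ψ.2 _) ψ
    have b2 := le_ciSup (bddAbove_range_of_abs_le (g := fun ψ : F => (1 / (k : ℝ)) *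
      ∑ i, (((-ε) i : ℤ) : ℝ) * (ψ : X → ℝ) (q i).2) fun ψ =>
        abs_average_signed_le hk (-ε) fun _ => hC ψ ψ.2 _) ψ
    refine (le_of_eq ?_).trans (add_le_add b1 b2)
    simp only
    rw [← mul_add, ← Finset.sum_add_distrib]
    congr 1
    refine Finset.sum_congr rfl fun i _ => ?_
    simp
    ring
  have hcard : (∑ _ε : Fin k → ℤˣ, (1 : ℝ)) = 2 ^ k := by
    simp
  have hR : rademacherComplexity ν F k = (1 / (2 : ℝ) ^ k) * ∑ ε, ∫ x, signedSup F ε x ∂P := by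
    rw [← integral_finsetSum _ fun ε _ => hTi ε, ← integral_const_mul]
    rfl
  have hneg : ∑ ε : Fin k → ℤˣ, ∫ x, signedSup F (-ε) x ∂P = ∑ ε, ∫ x, signedSup F ε x ∂P :=
    Equiv.sum_comp (Equiv.neg (Fin k → ℤˣ)) fun ε => ∫ x, signedSup F ε x ∂P
  set w := ∫ q, signedPairSup F (fun _ : Fin k => r) q ∂Q with hw
  have hsum : 2 ^ k * w ≤ 2 * ∑ ε, ∫ x, signedSup F ε x ∂P := by
    rw [← hcard, Finset.sum_mul, two_mul]
    nth_rewrite 2 [← hneg]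
    rw [← Finset.sum_add_distrib]
    refine Finset.sum_le_sum fun ε _ => ?_
    rw [one_mul, hswap ε]
    exact hsplit ε
  rw [hR]
  have h2k : (0 : ℝ) < 2 ^ k := by positivity
  rw [← mul_le_mul_iff_right₀ h2k]
  refine hsum.trans_eq ?_
  field_simp

/-- Only one summand of weight `1 / k` changes, by at most `2 C`, uniformly in `ψ`. -/
theorem abs_deviationSup_update_sub_le [IsProbabilityMeasure ν] [Nonempty F]
    (hC : ∀ ψ ∈ F, ∀ x, |ψ x| ≤ C) (hk : 1 ≤ k) (r : ℤˣ) (x : Fin k → X) (i : Fin k) (z : X) :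
    |deviationSup ν F r (Function.update x i z) - deviationSup ν F r x| ≤ 2 * C / k := by
  have hk0 : (0 : ℝ) < k := by exact_mod_cast hk
  refine abs_ciSup_sub_ciSup_le
    (bddAbove_range_of_abs_le fun ψ => abs_deviation_le hk r (hC ψ ψ.2) _)
    (bddAbove_range_of_abs_le fun ψ => abs_deviation_le hk r (hC ψ ψ.2) _) fun ψ => ?_
  rw [add_sub_add_left_eq_sub, ← Finset.sum_sub_distrib,
    Finset.sum_eq_single i (fun j _ hj => by simp [Function.update_of_ne hj]) (by simp),
    Function.update_self, ← mul_sub, abs_mul, abs_div, abs_neg,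
    show |((r : ℤ) : ℝ)| = 1 by simpa using abs_intUnit_mul r 1, Nat.abs_cast, div_mul_eq_mul_div,
    one_mul]
  gcongr
  exact (abs_sub _ _).trans (by linarith [hC ψ ψ.2 z, hC ψ ψ.2 (x i)])

/-- Uniform deviation bound in terms of the Rademacher complexity. -/
theorem measure_exists_deviation_le [IsProbabilityMeasure ν] [Nonempty F]
    (hFm : ∀ ψ ∈ F, Measurable ψ) (hF : HasMeasurableSuprema ν F)
    (hC : ∀ ψ ∈ F, ∀ x, |ψ x| ≤ C) (hk : 1 ≤ k) {L : ℝ} (hL : 0 ≤ L) :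
    (Measure.pi fun _ : Fin k => ν)
      {x | ∃ ψ ∈ F, 2 * rademacherComplexity ν F k + 2 * C * √(L / (2 * k))
        < |∫ u, ψ u ∂ν - (1 / (k : ℝ)) * ∑ i, ψ (x i)|}
      ≤ ENNReal.ofReal (2 * Real.exp (-L)) := by
  have hk0 : (0 : ℝ) < k := by exact_mod_cast hk
  obtain ⟨z0⟩ : Nonempty X := nonempty_of_isProbabilityMeasure ν
  obtain ⟨ψ0⟩ := ‹Nonempty F›
  have : Nonempty F := ⟨ψ0⟩
  have hC0 : 0 ≤ C := (abs_nonneg _).trans (hC ψ0 ψ0.2 z0)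
  have htail : ∀ r : ℤˣ, (Measure.pi fun _ : Fin k => ν)
      {x | 2 * C * √(L / (2 * k)) < deviationSup ν F r x
        - ∫ y, deviationSup ν F r y ∂(Measure.pi fun _ : Fin k => ν)}
      ≤ ENNReal.ofReal (Real.exp (-L)) := by
    intro r
    have h1 := measure_sqrt_lt_le_of_hasSubgaussianMGF
      (hasSubgaussianMGF_of_bounded_differences ν (f := deviationSup ν F r) (hF k _ _)
        (fun x => abs_ciSup_le fun ψ => abs_deviation_le hk r (hC ψ ψ.2) x)
        (abs_deviationSup_update_sub_le hC hk r)) hL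
    have h2 : √(2 * ((k * (‖2 * C / k‖₊ / 2) ^ 2 : NNReal) : ℝ) * L)
        = 2 * C * √(L / (2 * k)) := by
      rw [← Real.sqrt_sq (show 0 ≤ 2 * C * √(L / (2 * k)) by positivity)]
      congr 1
      rw [mul_pow, Real.sq_sqrt (by positivity)]
      simp only [div_pow, NNReal.coe_mul, NNReal.coe_natCast, NNReal.coe_div, NNReal.coe_pow,
        coe_nnnorm, Real.norm_eq_abs, sq_abs, NNReal.coe_ofNat]
      field_simp
    rwa [h2] at h1
  rw [two_mul (Real.exp (-L)), ENNReal.ofReal_add (Real.exp_pos _).le (Real.exp_pos _).le]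
  refine (measure_mono ?_).trans
    ((measure_union_le _ _).trans (add_le_add (htail 1) (htail (-1))))
  rintro x ⟨ψ, hψ, hx⟩
  have key : ∀ r : ℤˣ, ((r : ℤ) : ℝ) * (∫ u, ψ u ∂ν - (1 / (k : ℝ)) * ∑ i, ψ (x i))
      - 2 * rademacherComplexity ν F k ≤ deviationSup ν F r x
        - ∫ y, deviationSup ν F r y ∂(Measure.pi fun _ : Fin k => ν) := by
    intro r
    rw [← deviation_eq]
    exact sub_le_sub (le_ciSup (bddAbove_range_of_abs_le (B := 2 * C)
      (g := fun ψ : F => ((r : ℤ) : ℝ) * (∫ u, (ψ : X → ℝ) u ∂ν)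
        + ∑ i, (-((r : ℤ) : ℝ) / k) * (ψ : X → ℝ) (x i))
      fun ψ => abs_deviation_le hk r (hC ψ ψ.2) x) ⟨ψ, hψ⟩)
      (integral_deviationSup_le hFm hF hC hk r)
  have k1 := key 1
  have k2 := key (-1)
  simp only [Set.mem_union, Set.mem_ofPred_eq]
  rcases lt_abs.1 hx with h | h
  · left
    simp only [Units.val_one, Int.cast_one, one_mul] at k1
    linarith
  · right
    simp only [Units.val_neg, Units.val_one, Int.cast_neg, Int.cast_one] at k2
    linarith

end Symmetrization

/-! ### Conditioning on the labels -/

section Conditioning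

variable {Z : Type*} [MeasurableSpace Z]

/-- Conditioning a product measure on a product set gives the product of the conditioned
measures. -/
theorem cond_pi_univ_pi {n : ℕ} (p : Measure Z) [IsProbabilityMeasure p] {B : Fin n → Set Z}
    (hB : ∀ t, MeasurableSet (B t)) (h0 : ∀ t, p (B t) ≠ 0) :
    ProbabilityTheory.cond (Measure.pi fun _ : Fin n => p) (Set.univ.pi B)
      = Measure.pi fun t => ProbabilityTheory.cond p (B t) := by
  have hprob : ∀ t, IsProbabilityMeasure (ProbabilityTheory.cond p (B t)) := fun t =>
    cond_isProbabilityMeasure (h0 t)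
  refine (Measure.pi_eq fun S hS => ?_).symm
  rw [cond_apply (MeasurableSet.univ_pi hB), ← Set.pi_inter_distrib, Measure.pi_pi,
    Measure.pi_pi, ENNReal.prod_inv_distrib (fun i _ j _ _ => Or.inl (h0 i)),
    ← Finset.prod_mul_distrib]
  exact Finset.prod_congr rfl fun t _ => (cond_apply (hB t) p (S t)).symm

theorem map_comp_injective_pi {W : Type*} [MeasurableSpace W] {ι κ : Type*} [Fintype ι]
    [Fintype κ] (q : κ → Measure Z) [∀ t, IsProbabilityMeasure (q t)] {g : Z → W}
    (hg : Measurable g) {e : ι → κ} (he : Function.Injective e) :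
    (Measure.pi q).map (fun s i => g (s (e i))) = Measure.pi fun i => (q (e i)).map g := by
  have h1 := (iIndepFun_pi (μ := q) (X := fun _ => g) fun _ => hg.aemeasurable).precomp he
  rw [(iIndepFun_iff_map_fun_eq_pi_map (f := fun i (s : κ → Z) => g (s (e i)))
    fun i => (hg.comp (measurable_pi_apply (e i))).aemeasurable).1 h1]
  congr 1
  ext1 i
  have h2 := measurePreserving_eval q (e i)
  conv_rhs => rw [← h2.map_eq, Measure.map_map hg h2.measurable]
  rfl

variable {X Y : Type*} [MeasurableSpace X] [MeasurableSpace Y] [MeasurableSingletonClass Y]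

/-- To bound the probability of an event it suffices to bound it conditionally on the labels. -/
theorem measure_le_of_forall_labels [Fintype Y] {n : ℕ} (p : Measure (X × Y)) [IsProbabilityMeasure p]
    {E : Set (Fin n → X × Y)} {c : ENNReal}
    (h : ∀ v : Fin n → Y, (Measure.pi fun _ : Fin n => p)
        ((Set.univ.pi fun t => Prod.snd ⁻¹' {v t}) ∩ E)
      ≤ (Measure.pi fun _ : Fin n => p) (Set.univ.pi fun t => Prod.snd ⁻¹' {v t}) * c) :
    (Measure.pi fun _ : Fin n => p) E ≤ c := by
  set P := Measure.pi fun _ : Fin n => p with hP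
  have hpre : ∀ v : Fin n → Y, (fun (s : Fin n → X × Y) t => (s t).2) ⁻¹' {v}
      = Set.univ.pi fun t => Prod.snd ⁻¹' {v t} := by
    intro v
    ext s
    simp [funext_iff]
  have hmeas : ∀ v : Fin n → Y,
      MeasurableSet (Set.univ.pi fun t => Prod.snd ⁻¹' {v t} : Set (Fin n → X × Y)) := fun v =>
    MeasurableSet.univ_pi fun t => measurable_snd (measurableSet_singleton _)
  have htotal : ∑ v : Fin n → Y, P (Set.univ.pi fun t => Prod.snd ⁻¹' {v t}) = 1 := by
    simp_rw [← hpre]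
    rw [sum_measure_preimage_singleton _ fun v _ => by rw [hpre]; exact hmeas v]
    simp
  have hcover : E ⊆ ⋃ v ∈ (Finset.univ : Finset (Fin n → Y)),
      (Set.univ.pi fun t => Prod.snd ⁻¹' {v t}) ∩ E := by
    intro s hs
    simp only [Set.mem_iUnion]
    exact ⟨fun t => (s t).2, Finset.mem_univ _, by simp, hs⟩
  calc P E ≤ _ := measure_mono hcover
    _ ≤ ∑ v : Fin n → Y, P ((Set.univ.pi fun t => Prod.snd ⁻¹' {v t}) ∩ E) :=
      measure_biUnion_finset_le _ _
    _ ≤ ∑ v : Fin n → Y, P (Set.univ.pi fun t => Prod.snd ⁻¹' {v t}) * c :=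
      Finset.sum_le_sum fun v _ => h v
    _ = c := by rw [← Finset.sum_mul, htotal, one_mul]

/-- Uniform deviation of the averages over the samples with label `j`, the number of which is
random. -/
theorem measure_label_deviation_le [Fintype Y] [DecidableEq Y] {n : ℕ} (p : Measure (X × Y)) [IsProbabilityMeasure p]
    {F : Set (X → ℝ)} [Nonempty F] (hFm : ∀ ψ ∈ F, Measurable ψ) {C : ℝ}
    (hC : ∀ ψ ∈ F, ∀ x, |ψ x| ≤ C) (j : Y)
    (hF : p (Prod.snd ⁻¹' {j}) ≠ 0 → HasMeasurableSuprema (condInstance p j) F) {L : ℝ}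
    (hL : 0 ≤ L) :
    (Measure.pi fun _ : Fin n => p)
      {s | 1 ≤ labelCount s j ∧ (p (Prod.snd ⁻¹' {j}) ≠ 0 → ∃ ψ ∈ F,
        2 * rademacherComplexity (condInstance p j) F (labelCount s j)
            + 2 * C * √(L / (2 * labelCount s j))
          < |∫ u, ψ u ∂(condInstance p j) - (1 / (labelCount s j : ℝ)) *
              ∑ t, if (s t).2 = j then ψ (s t).1 else 0|)}
      ≤ ENNReal.ofReal (2 * Real.exp (-L)) := by
  refine measure_le_of_forall_labels p fun v => ?_
  set P := Measure.pi fun _ : Fin n => p with hP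
  set B : Set (Fin n → X × Y) := Set.univ.pi fun t => Prod.snd ⁻¹' {v t} with hB
  have hBt : ∀ t, MeasurableSet (Prod.snd ⁻¹' {v t} : Set (X × Y)) := fun t =>
    measurable_snd (measurableSet_singleton _)
  have hBm : MeasurableSet B := MeasurableSet.univ_pi hBt
  by_cases hB0 : P B = 0
  · exact (measure_mono_null Set.inter_subset_left hB0).trans_le zero_le
  have hBt0 : ∀ t, p (Prod.snd ⁻¹' {v t}) ≠ 0 := by
    rw [hB, hP, Measure.pi_pi, ← ne_eq, Finset.prod_ne_zero_iff] at hB0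
    exact fun t => hB0 t (Finset.mem_univ t)
  set T : Finset (Fin n) := Finset.univ.filter fun t => v t = j with hT
  set k := T.card with hk
  have hcount : ∀ s ∈ B, labelCount s j = k := by
    intro s hs
    have h1 : ∀ t, (s t).2 = v t := fun t => hs t (Set.mem_univ t)
    simp [labelCount, h1, hk, hT]
  rcases Nat.eq_zero_or_pos k with hk0 | hk0
  · refine le_of_eq_of_le ?_ zero_le
    convert measure_empty (μ := P)
    ext s
    simp only [Set.mem_inter_iff, Set.mem_ofPred_eq, Set.mem_empty_iff_false, iff_false]
    rintro ⟨hs, h1, -⟩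
    rw [hcount s hs] at h1
    omega
  obtain ⟨t0, ht0⟩ := Finset.card_pos.1 hk0
  have hj0 : p (Prod.snd ⁻¹' {j}) ≠ 0 := by
    rw [← (Finset.mem_filter.1 ht0).2]; exact hBt0 t0
  have hprob : ∀ t, IsProbabilityMeasure (ProbabilityTheory.cond p (Prod.snd ⁻¹' {v t})) :=
    fun t => cond_isProbabilityMeasure (hBt0 t)
  have hprobj : IsProbabilityMeasure (ProbabilityTheory.cond p (Prod.snd ⁻¹' {j})) :=
    cond_isProbabilityMeasure hj0
  have hν : IsProbabilityMeasure (condInstance p j) :=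
    Measure.isProbabilityMeasure_map measurable_fst.aemeasurable
  -- With the labels frozen at `v`, the positions carrying label `j` are deterministic; `e` lists
  -- them, turning the random sample size into a fixed `k`.
  set e : Fin k → Fin n := fun i => T.orderEmbOfFin hk.symm i with he
  have hej : ∀ i, v (e i) = j := fun i =>
    (Finset.mem_filter.1 (T.orderEmbOfFin_mem hk.symm i)).2
  have heinj : Function.Injective e := (T.orderEmbOfFin hk.symm).injective
  have hsum : ∀ g : Fin n → ℝ, ∑ t, (if v t = j then g t else 0) = ∑ i, g (e i) := by
    intro g
    rw [← Finset.sum_filter, ← hT, ← T.image_orderEmbOfFin_univ hk.symm,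
      Finset.sum_image fun a _ b _ h => heinj h]
  have hmap : (ProbabilityTheory.cond P B).map (fun (s : Fin n → X × Y) i => (s (e i)).1)
      = Measure.pi fun _ : Fin k => condInstance p j := by
    rw [hP, hB, cond_pi_univ_pi p hBt hBt0, map_comp_injective_pi _ measurable_fst heinj]
    congr 1
    ext1 i
    rw [hej]
    rfl
  have hunif := measure_exists_deviation_le hFm (hF hj0) hC hk0 hL
  rw [← hmap] at hunif
  -- This inequality holds for every set, so the event with an existential over an uncountable `F`
  -- need not be measurable.
  have h1 := (Measure.le_map_apply
    (f := fun (s : Fin n → X × Y) i => (s (e i)).1) (measurable_pi_iff.2 fun i =>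
      measurable_fst.comp (measurable_pi_apply (e i))).aemeasurable _).trans hunif
  rw [cond_apply hBm] at h1
  have h2 := mul_le_mul_right h1 (P B)
  rw [← mul_assoc, ENNReal.mul_inv_cancel hB0 (measure_ne_top _ _), one_mul] at h2
  refine (measure_mono ?_).trans h2
  rintro s ⟨hs, -, h3⟩
  obtain ⟨ψ, hψ, h4⟩ := h3 hj0
  refine ⟨hs, ψ, hψ, ?_⟩
  have h5 : ∀ t, (s t).2 = v t := fun t => hs t (Set.mem_univ t)
  simp only [hcount s hs, h5, hsum] at h4
  exact h4

/-- Restricting `p` to the label slice is its mass times the conditional law; for a null label both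
sides vanish. -/
theorem integral_ite_label_eq [DecidableEq Y] (p : Measure (X × Y)) [IsProbabilityMeasure p] {ψ : X → ℝ}
    (hψ : Measurable ψ) (j : Y) :
    ∫ z : X × Y, (if z.2 = j then ψ z.1 else 0) ∂p
      = p.real (Prod.snd ⁻¹' {j}) * ∫ u, ψ u ∂(condInstance p j) := by
  have hA : MeasurableSet (Prod.snd ⁻¹' {j} : Set (X × Y)) :=
    measurable_snd (measurableSet_singleton _)
  have h1 : (fun z : X × Y => if z.2 = j then ψ z.1 else 0)
      = (Prod.snd ⁻¹' {j} : Set (X × Y)).indicator fun z => ψ z.1 := by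
    ext z
    by_cases hz : z.2 = j <;> simp [Set.indicator, hz]
  rw [h1, integral_indicator hA, condInstance,
    integral_map measurable_fst.aemeasurable hψ.aestronglyMeasurable, ProbabilityTheory.cond,
    integral_smul_measure, smul_eq_mul, ← mul_assoc]
  by_cases h0 : p (Prod.snd ⁻¹' {j}) = 0
  · rw [Measure.restrict_eq_zero.2 h0]
    simp
  · rw [Measure.real, ENNReal.toReal_inv, mul_inv_cancel₀, one_mul]
    exact ENNReal.toReal_ne_zero.2 ⟨h0, measure_ne_top _ _⟩

end Conditioning

/-! ### Union bounds and the confidence vectors -/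

section Coverage

theorem HasCoverage.mono {Z ι : Type*} [MeasurableSpace Z] {n : ℕ} {p : Measure Z}
    {Φ : (Fin n → Z) → Z → ι → ℝ} {lam lam' : (Fin n → Z) → ι → ℝ} {δ : ℝ}
    (h : HasCoverage p Φ lam δ) (hle : ∀ s i, lam s i ≤ lam' s i) : HasCoverage p Φ lam' δ := by
  refine (measure_mono fun s hs => ?_).trans h
  simp only [Set.mem_ofPred_eq] at hs ⊢
  exact fun h' => hs fun i => (h' i).trans (hle s i)

/-- A union bound over finitely many events that cover the failure event. -/
theorem hasCoverage_of_cover {Z ι α : Type*} [MeasurableSpace Z] {n : ℕ} {p : Measure Z}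
    {Φ : (Fin n → Z) → Z → ι → ℝ} {lam : (Fin n → Z) → ι → ℝ} {δ c : ℝ} (A : Finset α)
    (E : α → Set (Fin n → Z))
    (hcover : ∀ s i, lam s i < |(∫ z, Φ s z i ∂p) - sampleMean (Φ s) s i| → ∃ a ∈ A, s ∈ E a)
    (hE : ∀ a ∈ A, (Measure.pi fun _ : Fin n => p) (E a) ≤ ENNReal.ofReal c)
    (hc : A.card * c ≤ δ) : HasCoverage p Φ lam δ := by
  refine (measure_mono (t := ⋃ a ∈ A, E a) fun s hs => ?_).trans
    ((measure_biUnion_finset_le A E).trans ((Finset.sum_le_sum hE).trans ?_))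
  · simp only [Set.mem_ofPred_eq, not_forall, not_le] at hs
    obtain ⟨i, hi⟩ := hs
    obtain ⟨a, ha, hsa⟩ := hcover s i hi
    simp only [Set.mem_iUnion]
    exact ⟨a, ha, hsa⟩
  · rw [Finset.sum_const, nsmul_eq_mul, ← ENNReal.ofReal_natCast,
      ← ENNReal.ofReal_mul (Nat.cast_nonneg _)]
    exact ENNReal.ofReal_le_ofReal hc

theorem hasCoverage_of_one_le {Z ι : Type*} [MeasurableSpace Z] {n : ℕ} {p : Measure Z}
    [IsProbabilityMeasure p] {Φ : (Fin n → Z) → Z → ι → ℝ} {lam : (Fin n → Z) → ι → ℝ} {δ : ℝ}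
    (hδ : 1 ≤ δ) : HasCoverage p Φ lam δ :=
  prob_le_one.trans (by simpa using hδ)

theorem hasCoverage_of_isEmpty {Z ι : Type*} [MeasurableSpace Z] [IsEmpty ι] {n : ℕ}
    {p : Measure Z} {Φ : (Fin n → Z) → Z → ι → ℝ} {lam : (Fin n → Z) → ι → ℝ} {δ : ℝ} :
    HasCoverage p Φ lam δ := by
  simp [HasCoverage]

theorem measurable_ite_label {X Y : Type*} [MeasurableSpace X] [DecidableEq Y] [MeasurableSpace Y]
    [MeasurableSingletonClass Y] {ψ : X → ℝ} (hψ : Measurable ψ) (j : Y) :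
    Measurable fun z : X × Y => if z.2 = j then ψ z.1 else 0 :=
  Measurable.ite (measurable_snd (measurableSet_singleton j)) (hψ.comp measurable_fst)
    measurable_const

theorem abs_ite_label_le {X Y : Type*} [DecidableEq Y] {ψ : X → ℝ} {C : ℝ} (hC0 : 0 ≤ C)
    (hψ : ∀ x, |ψ x| ≤ C) (j : Y) (z : X × Y) :
    |if z.2 = j then ψ z.1 else 0| ≤ C := by
  split_ifs
  · exact hψ _
  · simpa using hC0

theorem log_div_nonneg {c δ : ℝ} (hc : 1 ≤ c) (hδ : 0 < δ) (hδ1 : δ ≤ 1) :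
    0 ≤ Real.log (c / δ) :=
  Real.log_nonneg (by rw [le_div_iff₀ hδ]; linarith)

theorem exp_neg_log_div {c δ : ℝ} (hc : 0 < c) (hδ : 0 < δ) :
    Real.exp (-Real.log (c / δ)) = δ / c := by
  rw [Real.exp_neg, Real.exp_log (by positivity), inv_div]

/-- The label frequency bound and the conditional average bound combine into a bound for the
average of the one-hot feature. -/
theorem abs_mul_sub_mul_le {q N n E M C R r L : ℝ} (hN : 0 < N) (hn : 0 < n)
    (hE : |E| ≤ C) (h1 : |q - N / n| ≤ √(L / (2 * n)))
    (h2 : |E - M| ≤ 2 * r + 2 * C * √(L / (2 * N))) (hr : r ≤ R / √N) :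
    |q * E - N / n * M| ≤ 2 * √(N / n) * (R / √n) + C * (1 + 2 * √(N / n)) * √(L / (2 * n)) := by
  have hN' : √N ^ 2 = N := Real.sq_sqrt hN.le
  have hn' : √n ^ 2 = n := Real.sq_sqrt hn.le
  have hN0 : 0 < √N := Real.sqrt_pos.2 hN
  have hn0 : 0 < √n := Real.sqrt_pos.2 hn
  -- The weight `N / n` cancels one factor `√N`, here and in `e2`.
  have e1 : N / n * (R / √N) = √(N / n) * (R / √n) := by
    rw [Real.sqrt_div hN.le]
    nth_rewrite 1 [← hN']
    nth_rewrite 1 [← hn']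
    field_simp
  have e2 : N / n * √(L / (2 * N)) = √(N / n) * √(L / (2 * n)) := by
    rw [← Real.sqrt_mul (by positivity), show N / n * (L / (2 * n))
      = (N / n) ^ 2 * (L / (2 * N)) by field_simp, Real.sqrt_mul (by positivity),
      Real.sqrt_sq (by positivity)]
  have hNn : 0 ≤ N / n := by positivity
  calc |q * E - N / n * M| = |(q - N / n) * E + N / n * (E - M)| := by ring_nf
    _ ≤ |q - N / n| * |E| + N / n * |E - M| := by
      refine (abs_add_le _ _).trans ?_
      rw [abs_mul, abs_mul, abs_of_nonneg hNn]
    _ ≤ √(L / (2 * n)) * C + N / n * (2 * (R / √N) + 2 * C * √(L / (2 * N))) := by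
      gcongr
      linarith
    _ = _ := by linear_combination 2 * e1 + 2 * C * e2

variable {X Y : Type*} [MeasurableSpace X] [Fintype Y] [DecidableEq Y] [MeasurableSpace Y]
  [MeasurableSingletonClass Y] {p : Measure (X × Y)} [IsProbabilityMeasure p]
  {F : Set (X → ℝ)} {C : ℝ} {n K : ℕ} {δ : ℝ} {Ψ : (Fin n → X × Y) → Fin K → X → ℝ}

/-- The union runs over all of `F × Y`, whatever the selection picks, and `2 |F| |Y| exp (-L) = δ`
exactly. -/
theorem hasCoverage_hoeffding (hFmeas : ∀ ψ ∈ F, Measurable ψ) (hC0 : 0 ≤ C)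
    (hC : ∀ ψ ∈ F, ∀ x, |ψ x| ≤ C) (hn : 1 ≤ n) (hδ : 0 < δ) (hδ1 : δ ≤ 1)
    (hΨ : ∀ s l, Ψ s l ∈ F) (hF : F.Finite) (hM : 1 ≤ F.ncard * Fintype.card Y) :
    HasCoverage p (fun s => oneHotFeature (Y := Y) (Ψ s))
      (fun _ _ => C * √(2 * Real.log (2 * F.ncard * Fintype.card Y / δ) / n)) δ := by
  have hM' : (1 : ℝ) ≤ F.ncard * Fintype.card Y := by exact_mod_cast hM
  set L := Real.log (2 * F.ncard * Fintype.card Y / δ) with hL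
  have hL0 : 0 ≤ L := log_div_nonneg (by linarith) hδ hδ1
  refine hasCoverage_of_cover (c := 2 * Real.exp (-L)) (hF.toFinset ×ˢ Finset.univ)
    (fun a : (X → ℝ) × Y => {s | C * √(2 * L / n)
      < |∫ z : X × Y, (if z.2 = a.2 then a.1 z.1 else 0) ∂p
        - (1 / (n : ℝ)) * ∑ t, if (s t).2 = a.2 then a.1 (s t).1 else 0|})
    (fun s i hi => ⟨(Ψ s i.2, i.1), by simp [hΨ s i.2], hi⟩) (fun a ha => ?_) ?_
  · have haF : a.1 ∈ F := by simpa using ha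
    have h1 := hoeffding_abs_sampleMean p (measurable_ite_label (hFmeas _ haF) a.2)
      (a := -C) (b := C) (fun z => abs_le.1 (abs_ite_label_le hC0 (hC _ haF) a.2 z)) hn hL0
    have h2 : (C - -C) * √(L / (2 * n)) = C * √(2 * L / n) := by
      rw [show 2 * L / (n : ℝ) = 2 ^ 2 * (L / (2 * n)) by
        have : (n : ℝ) ≠ 0 := by positivity
        field_simp, Real.sqrt_mul (by norm_num), Real.sqrt_sq (by norm_num)]
      ring
    rwa [h2] at h1
  · rw [Finset.card_product, ← Set.ncard_eq_toFinset_card F hF, Finset.card_univ, hL,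
      exp_neg_log_div (by linarith) hδ]
    push_cast
    refine le_of_eq ?_
    have : (F.ncard : ℝ) ≠ 0 := by rintro h; rw [h] at hM'; norm_num at hM'
    have : (Fintype.card Y : ℝ) ≠ 0 := by rintro h; rw [h] at hM'; norm_num at hM'
    field_simp

/-- Three tails per pair against the constant `4` in the logarithm: the total failure probability is
at most `3 δ / 4`. -/
theorem hasCoverage_empirical_bernstein (hFmeas : ∀ ψ ∈ F, Measurable ψ) (hC0 : 0 ≤ C)
    (hC : ∀ ψ ∈ F, ∀ x, |ψ x| ≤ C) (hn : 2 ≤ n) (hδ : 0 < δ) (hδ1 : δ ≤ 1)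
    (hΨ : ∀ s l, Ψ s l ∈ F) (hF : F.Finite) (hM : 1 ≤ F.ncard * Fintype.card Y) :
    HasCoverage p (fun s => oneHotFeature (Y := Y) (Ψ s))
      (fun s i =>
        √(2 * sampleVariance (oneHotFeature (Y := Y) (Ψ s)) s i *
            Real.log (4 * F.ncard * Fintype.card Y / δ) / n) +
          14 * C * Real.log (4 * F.ncard * Fintype.card Y / δ) / (3 * ((n : ℝ) - 1))) δ := by
  have hM' : (1 : ℝ) ≤ F.ncard * Fintype.card Y := by exact_mod_cast hM
  set L := Real.log (4 * F.ncard * Fintype.card Y / δ) with hL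
  have hL0 : 0 ≤ L := log_div_nonneg (by linarith) hδ hδ1
  refine hasCoverage_of_cover (c := 3 * Real.exp (-L)) (hF.toFinset ×ˢ Finset.univ)
    (fun a : (X → ℝ) × Y => {s |
      √(2 * ((1 / ((n : ℝ) - 1)) * ∑ t, ((if (s t).2 = a.2 then a.1 (s t).1 else 0)
            - (1 / (n : ℝ)) * ∑ u, if (s u).2 = a.2 then a.1 (s u).1 else 0) ^ 2) * L / n)
          + 14 * C * L / (3 * ((n : ℝ) - 1))
      < |∫ z : X × Y, (if z.2 = a.2 then a.1 z.1 else 0) ∂p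
        - (1 / (n : ℝ)) * ∑ t, if (s t).2 = a.2 then a.1 (s t).1 else 0|})
    (fun s i hi => ⟨(Ψ s i.2, i.1), by simp [hΨ s i.2], hi⟩) (fun a ha => ?_) ?_
  · have haF : a.1 ∈ F := by simpa using ha
    exact empirical_bernstein_abs_sampleMean p (measurable_ite_label (hFmeas _ haF) a.2)
      (abs_ite_label_le hC0 (hC _ haF) a.2) hn hL0
  · rw [Finset.card_product, ← Set.ncard_eq_toFinset_card F hF, Finset.card_univ, hL,
      exp_neg_log_div (by linarith) hδ]
    push_cast
    have : (F.ncard : ℝ) ≠ 0 := by rintro h; rw [h] at hM'; norm_num at hM'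
    have : (Fintype.card Y : ℝ) ≠ 0 := by rintro h; rw [h] at hM'; norm_num at hM'
    field_simp
    norm_num

/-- The deviation bound is uniform over `F`, so the union is over labels only. Each label costs `2
exp (-L)` for its frequency and `2 exp (-L)` for its conditional averages. -/
theorem hasCoverage_rademacher (hFmeas : ∀ ψ ∈ F, Measurable ψ) (hC0 : 0 ≤ C)
    (hC : ∀ ψ ∈ F, ∀ x, |ψ x| ≤ C) (hn : 1 ≤ n) (hδ : 0 < δ) (hδ1 : δ ≤ 1)
    (hΨ : ∀ s l, Ψ s l ∈ F) [Nonempty F] (hY : 1 ≤ Fintype.card Y) (R : ℝ)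
    (hR : ∀ j : Y, p (Prod.snd ⁻¹' {j}) ≠ 0 →
      HasMeasurableSuprema (condInstance p j) F ∧
      ∀ k : ℕ, 1 ≤ k → k ≤ n → rademacherComplexity (condInstance p j) F k ≤ R / √(k : ℝ)) :
    HasCoverage p (fun s => oneHotFeature (Y := Y) (Ψ s))
      (fun s i =>
        2 * √((labelCount s i.1 : ℝ) / n) * (R / √(n : ℝ)) +
          C * (1 + 2 * √((labelCount s i.1 : ℝ) / n)) *
            √(Real.log (4 * Fintype.card Y / δ) / (2 * n))) δ := by
  have hn0 : (0 : ℝ) < n := by exact_mod_cast hn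
  have hY' : (1 : ℝ) ≤ Fintype.card Y := by exact_mod_cast hY
  set L := Real.log (4 * Fintype.card Y / δ) with hL
  have hL0 : 0 ≤ L := log_div_nonneg (by linarith) hδ hδ1
  refine hasCoverage_of_cover (c := 4 * Real.exp (-L)) Finset.univ
    (fun j : Y => {s : Fin n → X × Y | (1 - 0) * √(L / (2 * n))
        < |∫ z : X × Y, (if z.2 = j then 1 else 0 : ℝ) ∂p
          - (1 / (n : ℝ)) * ∑ t, if (s t).2 = j then 1 else 0|} ∪
      {s | 1 ≤ labelCount s j ∧ (p (Prod.snd ⁻¹' {j}) ≠ 0 → ∃ ψ ∈ F,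
        2 * rademacherComplexity (condInstance p j) F (labelCount s j)
            + 2 * C * √(L / (2 * labelCount s j))
          < |∫ u, ψ u ∂(condInstance p j) - (1 / (labelCount s j : ℝ)) *
              ∑ t, if (s t).2 = j then ψ (s t).1 else 0|)})
    (fun s i hi => ⟨i.1, Finset.mem_univ _, ?_⟩) (fun j _ => ?_) ?_
  · obtain ⟨j, l⟩ := i
    by_contra hnot
    simp only [Set.mem_union, Set.mem_ofPred_eq, not_or, not_lt, not_and, not_forall, not_exists]
      at hnot
    obtain ⟨g1, g2⟩ := hnot
    have hψ := hΨ s l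
    have hint1 : ∫ z : X × Y, (if z.2 = j then 1 else 0 : ℝ) ∂p
        = p.real (Prod.snd ⁻¹' {j}) := by
      rw [← integral_indicator_one (measurable_snd (measurableSet_singleton j))]
      congr 1
      ext z
      by_cases hz : z.2 = j <;> simp [Set.indicator, hz]
    have hcount : (∑ t, if (s t).2 = j then (1 : ℝ) else 0) = labelCount s j := by
      simp [labelCount]
    rw [hint1, hcount, sub_zero, one_mul, one_div, ← div_eq_inv_mul] at g1
    have hint2 : ∫ z, oneHotFeature (Y := Y) (Ψ s) z (j, l) ∂p
        = p.real (Prod.snd ⁻¹' {j}) * ∫ u, Ψ s l u ∂(condInstance p j) :=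
      integral_ite_label_eq p (hFmeas _ hψ) j
    have hmean : sampleMean (oneHotFeature (Y := Y) (Ψ s)) s (j, l)
        = (1 / (n : ℝ)) * ∑ t, if (s t).2 = j then Ψ s l (s t).1 else 0 := rfl
    rw [hint2, hmean] at hi
    have hE : |∫ u, Ψ s l u ∂(condInstance p j)| ≤ C := by
      by_cases hj : p (Prod.snd ⁻¹' {j}) = 0
      · simpa [condInstance, ProbabilityTheory.cond, Measure.restrict_eq_zero.2 hj] using hC0
      · have := cond_isProbabilityMeasure hj
        have : IsProbabilityMeasure (condInstance p j) :=
          Measure.isProbabilityMeasure_map measurable_fst.aemeasurable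
        exact abs_integral_le_of_abs_le (hC _ hψ)
    refine absurd hi (not_lt.2 ?_)
    rcases Nat.eq_zero_or_pos (labelCount s j) with h0 | h0
    -- For an unseen label the sample mean is `0`, and the frequency bound alone gives the error `q
    -- |E| ≤ C √(L / (2 n))`.
    · have hz : ∀ t, (s t).2 ≠ j := by
        simpa [labelCount, Finset.card_eq_zero, Finset.filter_eq_empty_iff] using h0
      simp only [h0, Nat.cast_zero, zero_div, Real.sqrt_zero, mul_zero, zero_mul, zero_add,
        add_zero, mul_one, hz, if_false, Finset.sum_const_zero, sub_zero] at g1 ⊢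
      rw [abs_mul, mul_comm C]
      gcongr
    -- Outside the exceptional events, an observed label has positive probability, so `hR` applies
    -- to it.
    · obtain ⟨hj, g3⟩ := g2 h0
      have hle : labelCount s j ≤ n := (Finset.card_filter_le _ _).trans_eq (by simp)
      have hN0 : (0 : ℝ) < labelCount s j := by exact_mod_cast h0
      have key := abs_mul_sub_mul_le hN0 hn0 hE g1 (g3 _ hψ)
        ((hR j hj).2 _ h0 hle)
      rwa [show (labelCount s j : ℝ) / n * (1 / (labelCount s j : ℝ) *
        ∑ t, if (s t).2 = j then Ψ s l (s t).1 else 0)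
          = (1 / (n : ℝ)) * ∑ t, if (s t).2 = j then Ψ s l (s t).1 else 0 by
            field_simp] at key
  · have h1 := hoeffding_abs_sampleMean p (f := fun z : X × Y => if z.2 = j then 1 else 0)
      (measurable_ite_label (ψ := fun _ => 1) measurable_const j) (a := 0) (b := 1)
      (fun z => by by_cases hz : z.2 = j <;> simp [hz]) hn hL0
    have h2 := measure_label_deviation_le (n := n) p hFmeas hC j (fun hj => (hR j hj).1) hL0
    refine (measure_union_le _ _).trans ((add_le_add h1 h2).trans_eq ?_)
    rw [← ENNReal.ofReal_add (by positivity) (by positivity)]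
    ring_nf
  · rw [Finset.card_univ, hL, exp_neg_log_div (by linarith) hδ]
    refine le_of_eq ?_
    field_simp

end Coverage

theorem mainTheorem6 {X Y : Type*} [MeasurableSpace X] [Fintype Y] [DecidableEq Y]
    [MeasurableSpace Y] [MeasurableSingletonClass Y]
    (p : Measure (X × Y)) [IsProbabilityMeasure p]
    (F : Set (X → ℝ)) (hFmeas : ∀ ψ ∈ F, Measurable ψ)
    (C : ℝ) (hC : ∀ ψ ∈ F, ∀ x, |ψ x| ≤ C)
    (n : ℕ) (hn : 1 ≤ n) (δ : ℝ) (hδ : 0 < δ)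
    (K : ℕ) (Ψ : (Fin n → X × Y) → Fin K → X → ℝ) (hΨ : ∀ s l, Ψ s l ∈ F) :
    -- finite family: Hoeffding-type confidence vector
    (F.Finite →
      HasCoverage p (fun s => oneHotFeature (Y := Y) (Ψ s))
        (fun _ _ => C * √(2 * Real.log (2 * F.ncard * Fintype.card Y / δ) / n)) δ) ∧
    -- finite family: confidence vector with the sample variances
    (F.Finite → 2 ≤ n →
      HasCoverage p (fun s => oneHotFeature (Y := Y) (Ψ s))
        (fun s i =>
          √(2 * sampleVariance (oneHotFeature (Y := Y) (Ψ s)) s i *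
              Real.log (4 * F.ncard * Fintype.card Y / δ) / n) +
            14 * C * Real.log (4 * F.ncard * Fintype.card Y / δ) / (3 * ((n : ℝ) - 1))) δ) ∧
    -- the same with the factor `2 C`, for `C ≥ 1 / 2`
    (F.Finite → 2 ≤ n → 1 / 2 ≤ C →
      HasCoverage p (fun s => oneHotFeature (Y := Y) (Ψ s))
        (fun s i =>
          2 * C * √(2 * sampleVariance (oneHotFeature (Y := Y) (Ψ s)) s i *
              Real.log (4 * F.ncard * Fintype.card Y / δ) / n) +
            14 * C * Real.log (4 * F.ncard * Fintype.card Y / δ) / (3 * ((n : ℝ) - 1))) δ) ∧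
    -- general family: confidence vector with the Rademacher complexity
    (∀ R : ℝ,
      (∀ j : Y, p (Prod.snd ⁻¹' {j}) ≠ 0 →
        HasMeasurableSuprema (condInstance p j) F ∧
        ∀ k : ℕ, 1 ≤ k → k ≤ n →
          rademacherComplexity (condInstance p j) F k ≤ R / √(k : ℝ)) →
      HasCoverage p (fun s => oneHotFeature (Y := Y) (Ψ s))
        (fun s i =>
          2 * √((labelCount s i.1 : ℝ) / n) * (R / √(n : ℝ)) +
            C * (1 + 2 * √((labelCount s i.1 : ℝ) / n)) *
              √(Real.log (4 * Fintype.card Y / δ) / (2 * n))) δ) := by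
  obtain ⟨s0⟩ : Nonempty (Fin n → X × Y) := by
    have := nonempty_of_isProbabilityMeasure p
    infer_instance
  -- A feature is needed for `F` to be nonempty and `C` nonnegative. Then `δ ≥ 1` is trivial, and `δ
  -- ≤ 1` makes the logarithms nonnegative.
  rcases Nat.eq_zero_or_pos K with rfl | hK
  · exact ⟨fun _ => hasCoverage_of_isEmpty, fun _ _ => hasCoverage_of_isEmpty,
      fun _ _ _ => hasCoverage_of_isEmpty, fun _ _ => hasCoverage_of_isEmpty⟩
  rcases le_total 1 δ with hδ1 | hδ1
  · exact ⟨fun _ => hasCoverage_of_one_le hδ1, fun _ _ => hasCoverage_of_one_le hδ1,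
      fun _ _ _ => hasCoverage_of_one_le hδ1, fun _ _ => hasCoverage_of_one_le hδ1⟩
  have hψ0 : Ψ s0 ⟨0, hK⟩ ∈ F := hΨ _ _
  have hC0 : 0 ≤ C := (abs_nonneg _).trans (hC _ hψ0 (s0 ⟨0, hn⟩).1)
  have : Nonempty F := ⟨⟨_, hψ0⟩⟩
  have hY : 1 ≤ Fintype.card Y := Fintype.card_pos_iff.2 ⟨(s0 ⟨0, hn⟩).2⟩
  have hM : F.Finite → 1 ≤ F.ncard * Fintype.card Y := fun hF =>
    Nat.mul_pos ((Set.ncard_pos hF).2 ⟨_, hψ0⟩) hY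
  refine ⟨fun hF => hasCoverage_hoeffding hFmeas hC0 hC hn hδ hδ1 hΨ hF (hM hF),
    fun hF hn2 => hasCoverage_empirical_bernstein hFmeas hC0 hC hn2 hδ hδ1 hΨ hF (hM hF),
    fun hF hn2 hC2 => ?_, fun R hR => hasCoverage_rademacher hFmeas hC0 hC hn hδ hδ1 hΨ hY R hR⟩
  -- `C ≥ 1 / 2` means `2 C ≥ 1`, so this vector dominates the preceding one.
  refine (hasCoverage_empirical_bernstein hFmeas hC0 hC hn2 hδ hδ1 hΨ hF (hM hF)).mono
    fun s i => ?_
  gcongr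
  exact le_mul_of_one_le_left (Real.sqrt_nonneg _) (by linarith)
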